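/- Let $\mathbb B^k$ denote the open Euclidean unit ball in $\mathbb C^k$ and ${\rm Aut}(\mathbb B^k)$ the group of its holomorphic automorphisms, with the compact-open topology. Let ${\bf U}(k)$ act on $\mathbb B^k$ by $z\mapsto Uz$, so that ${\bf U}(k)\subseteq{\rm Aut}(\mathbb B^k)$. For a holomorphic map $f:\mathbb B^n\to\mathbb B^N$ let $$\Gamma_f=\{\gamma\in{\rm Aut}(\mathbb B^n): f\circ\gamma=\psi\circ f\ \text{ for some }\ \psi\in{\rm Aut}(\mathbb B^N)\}.$$ Maps $f,g:\mathbb B^n\to\mathbb B^N$ are called spherically equivalent if $\psi\circ g=f\circ\gamma$ for some $\gamma\in{\rm Aut}(\mathbb B^n)$ and $\psi\in{\rm Aut}(\mathbb B^N)$. Corollary 1.2. Let $f:\mathbb B^n\to\mathbb B^N$ be a proper holomorphic map. (i) If $\Gamma_f$ contains a maximal torus of ${\rm Aut}(\mathbb B^n)$, that is, a conjugate in ${\rm Aut}(\mathbb B^n)$ of the group ${\bf U}(1)\oplus\dots\oplus{\bf U}(1)$ of diagonal unitary matrices, then $f$ is spherically equivalent to a monomial map, i.e. to a map each of whose components has the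 form $c\,z^\alpha$ with $c\in\mathbb C$ (possibly $0$) and a multi-index $\alpha$. (ii) If $\Gamma_f$ contains ${\bf U}(n)$, then $f$ is spherically equivalent to an orthogonal sum of tensor products, i.e. to a map of the form $$g(z)=\sum_{m\in S}c_m\,V_m(z^{\otimes m}),$$ where $S$ is a finite set of positive integers, $c_m\in\mathbb C$, each $V_m$ is a linear isometry into $\mathbb C^N$ of the span of the tensors $z^{\otimes m}\in(\mathbb C^n)^{\otimes m}$, $z\in\mathbb C^n$, and the images of the $V_m$, $m\in S$, are mutually orthogonal. (iii) If $\Gamma_f$ contains the center of ${\bf U}(n)$ and $\Gamma_f$ is noncompact, then $f$ is a linear fractional transformation, i.e. $f(z)=\dfrac{Az+b}{\ell(z)+d}$ on $\mathbb B^n$ with $A:\mathbb C^n\to\mathbb C^N$ and $\ell:\mathbb C^n\to\mathbb C$ linear, $b\in\mathbb C^N$, $d\in\mathbb C$, and $\ell(z)+d\neq0$ for all $z\in\mathbb B^n$. -/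

import Mathlib

namespace BallMap

noncomputable section

/-- The open unit ball of `ℂⁿ` (with the Euclidean norm), as a type. -/
abbrev Ball (n : ℕ) : Type := Metric.ball (0 : EuclideanSpace ℂ (Fin n)) 1

/-- `f : 𝔹ⁿ → 𝔹ᴺ` is holomorphic: it is given by a function that is complex differentiable on the
open ball. -/
def IsHolomorphic {n N : ℕ} (f : Ball n → Ball N) : Prop :=
  ∃ F : EuclideanSpace ℂ (Fin n) → EuclideanSpace ℂ (Fin N),
    DifferentiableOn ℂ F (Metric.ball 0 1) ∧ ∀ z : Ball n, F z = f z

theorem IsHolomorphic.continuous {n N : ℕ} {f : Ball n → Ball N} (hf : IsHolomorphic f) :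
    Continuous f := by
  obtain ⟨F, hF, h⟩ := hf
  refine continuous_induced_rng.2 ?_
  have h2 : (Subtype.val ∘ f) = (Metric.ball (0 : EuclideanSpace ℂ (Fin n)) 1).domRestrict F := by
    ext1 z
    exact (h z).symm
  rw [h2]
  exact hF.continuousOn.domRestrict

theorem IsHolomorphic.comp {n m N : ℕ} {g : Ball m → Ball N} {f : Ball n → Ball m}
    (hg : IsHolomorphic g) (hf : IsHolomorphic f) : IsHolomorphic (g ∘ f) := by
  obtain ⟨G, hG, hG'⟩ := hg
  obtain ⟨F, hF, hF'⟩ := hf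
  refine ⟨G ∘ F, hG.comp hF ?_, fun z => ?_⟩
  · intro z hz
    rw [hF' ⟨z, hz⟩]
    exact (f ⟨z, hz⟩).2
  · simp only [Function.comp_apply]
    rw [hF' z, hG']

theorem isHolomorphic_id (n : ℕ) : IsHolomorphic (id : Ball n → Ball n) :=
  ⟨id, differentiableOn_id, fun _ => rfl⟩

/-- `Aut(𝔹ⁿ)`: the group (under composition) of biholomorphic self-maps of the ball. -/
def autSubgroup (n : ℕ) : Subgroup (Equiv.Perm (Ball n)) where
  carrier := {γ | IsHolomorphic γ ∧ IsHolomorphic γ.symm}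
  mul_mem' := fun ha hb => ⟨ha.1.comp hb.1, hb.2.comp ha.2⟩
  one_mem' := ⟨isHolomorphic_id n, isHolomorphic_id n⟩
  inv_mem' := fun ha => ⟨ha.2, ha.1⟩

/-- `Aut(𝔹ⁿ)` as a type. -/
abbrev Aut (n : ℕ) : Type := autSubgroup n

/-- An automorphism as a self-map of the ball. -/
def Aut.toFun {n : ℕ} (γ : Aut n) : Ball n → Ball n := γ.1

/-- An automorphism as a continuous self-map of the ball. -/
def Aut.toContinuousMap {n : ℕ} (γ : Aut n) : C(Ball n, Ball n) :=
  ⟨γ.toFun, γ.2.1.continuous⟩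

/-- The topology of `Aut(𝔹ⁿ)`: the compact-open topology, that is, uniform convergence on
compact subsets of the ball. -/
instance Aut.instTopologicalSpace (n : ℕ) : TopologicalSpace (Aut n) :=
  TopologicalSpace.induced Aut.toContinuousMap inferInstance

/-- Linear isometries of `ℂⁿ` restrict to automorphisms of the ball. -/
def isometryToAut (n : ℕ) :
    (EuclideanSpace ℂ (Fin n) ≃ₗᵢ[ℂ] EuclideanSpace ℂ (Fin n)) →* Aut n where
  toFun L :=
    ⟨{ toFun := fun z => ⟨L z, by simpa [-Subtype.coe_prop, -SetLike.coe_mem] using mem_ball_zero_iff.1 z.2⟩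
       invFun := fun z => ⟨L.symm z, by simpa [-Subtype.coe_prop, -SetLike.coe_mem] using mem_ball_zero_iff.1 z.2⟩
       left_inv := fun z => by simp
       right_inv := fun z => by simp },
      ⟨L, L.toContinuousLinearEquiv.differentiable.differentiableOn, fun _ => rfl⟩,
      ⟨L.symm, L.symm.toContinuousLinearEquiv.differentiable.differentiableOn, fun _ => rfl⟩⟩
  map_one' := rfl
  map_mul' _ _ := rfl

/-- A unitary matrix as a unitary operator on `ℂⁿ`. -/
def unitaryToOperator (n : ℕ) : Matrix.unitaryGroup (Fin n) ℂ →*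
    unitary (EuclideanSpace ℂ (Fin n) →L[ℂ] EuclideanSpace ℂ (Fin n)) where
  toFun U := ⟨Matrix.toEuclideanCLM (n := Fin n) (𝕜 := ℂ) U.1, Unitary.map_mem _ U.2⟩
  map_one' := Subtype.ext (map_one _)
  map_mul' U V := Subtype.ext (map_mul _ U.1 V.1)

/-- The unitary group `U(n)` acting on the ball by matrix multiplication `z ↦ U z`. -/
def unitaryToAut (n : ℕ) : Matrix.unitaryGroup (Fin n) ℂ →* Aut n :=
  ((isometryToAut n).comp Unitary.linearIsometryEquiv.toMonoidHom).comp (unitaryToOperator n)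

theorem unitaryToAut_apply (n : ℕ) (U : Matrix.unitaryGroup (Fin n) ℂ) (z : Ball n) :
    ((unitaryToAut n U).toFun z : EuclideanSpace ℂ (Fin n))
      = WithLp.toLp 2 (Matrix.mulVec U.1 (z : EuclideanSpace ℂ (Fin n)).ofLp) := rfl

/-- The diagonal torus `U(1) ⊕ ⋯ ⊕ U(1)` inside `U(n)`. -/
def diagonalTorus (n : ℕ) : Subgroup (Matrix.unitaryGroup (Fin n) ℂ) where
  carrier := {U | U.1.IsDiag}
  mul_mem' := fun {a b} ha hb => by
    have h : (a.1 * b.1).IsDiag := by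
      rw [← Matrix.IsDiag.diagonal_diag ha, ← Matrix.IsDiag.diagonal_diag hb,
        Matrix.diagonal_mul_diagonal]
      exact Matrix.isDiag_diagonal _
    exact h
  one_mem' := Matrix.isDiag_one
  inv_mem' := fun {a} ha => Matrix.IsDiag.conjTranspose ha

/-- `A_f`: the group of pairs `(γ, ψ)` of automorphisms with `f ∘ γ = ψ ∘ f`. -/
def equivariancePairs {n N : ℕ} (f : Ball n → Ball N) : Subgroup (Aut n × Aut N) where
  carrier := {p | f ∘ p.1.toFun = p.2.toFun ∘ f}
  mul_mem' := fun {a b} ha hb => by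
    funext z
    have h1 := congrFun ha (b.1.toFun z)
    have h2 := congrArg a.2.toFun (congrFun hb z)
    exact h1.trans h2
  one_mem' := rfl
  inv_mem' := fun {a} ha => by
    funext z
    have h1 := congrFun ha ((a⁻¹).1.toFun z)
    have h2 : a.1.toFun ((a⁻¹).1.toFun z) = z := Equiv.apply_symm_apply a.1.1 z
    simp only [Function.comp_apply, h2] at h1
    have h3 := congrArg (a⁻¹).2.toFun h1
    exact ((Equiv.symm_apply_apply a.2.1 (f ((a⁻¹).1.toFun z))).symm.trans h3.symm)

/-- `Γ_f`: the projection of `A_f` to its first factor. -/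
def sourceGroup {n N : ℕ} (f : Ball n → Ball N) : Subgroup (Aut n) :=
  (equivariancePairs f).map (MonoidHom.fst (Aut n) (Aut N))

/-- `f` and `g` are spherically equivalent: `ψ ∘ g = f ∘ γ` for some automorphisms `γ`, `ψ` of the
source and target balls. -/
def SphericallyEquivalent {n N : ℕ} (f g : Ball n → Ball N) : Prop :=
  ∃ (γ : Aut n) (ψ : Aut N), ψ.toFun ∘ g = f ∘ γ.toFun

/-- Every component of `g` is a monomial `c z^α` (the coefficient `c` may vanish). -/
def IsMonomialMap {n N : ℕ} (g : Ball n → Ball N) : Prop :=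
  ∀ j : Fin N, ∃ (c : ℂ) (α : Fin n → ℕ), ∀ z : Ball n,
    (g z : EuclideanSpace ℂ (Fin N)) j
      = c * ∏ i, (z : EuclideanSpace ℂ (Fin n)) i ^ α i

/-- The tensor power `z ⊗ ⋯ ⊗ z` (`m` factors) as an element of `(ℂⁿ)^{⊗ m}`, the Euclidean space
whose coordinates are indexed by `Fin m → Fin n`. -/
def tensorPow {n : ℕ} (m : ℕ) (z : EuclideanSpace ℂ (Fin n)) :
    EuclideanSpace ℂ (Fin m → Fin n) :=
  WithLp.toLp 2 fun s => ∏ i, z (s i)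

/-- The span of all `z^{⊗ m}`, that is, the symmetric tensors. -/
def symTensors (n m : ℕ) : Submodule ℂ (EuclideanSpace ℂ (Fin m → Fin n)) :=
  Submodule.span ℂ (Set.range (tensorPow (n := n) m))

/-- `z^{⊗ m}` as an element of the space of symmetric tensors. -/
def symPow {n : ℕ} (m : ℕ) (z : EuclideanSpace ℂ (Fin n)) : symTensors n m :=
  ⟨tensorPow m z, Submodule.subset_span (Set.mem_range_self z)⟩

/-- `g` is an orthogonal sum of tensor products `⊕_{m ∈ S} c_m z^{⊗ m}` with finitely many distinct
degrees `m ≥ 1`. The isometries `V m` place the summands into mutually orthogonal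
subspaces of the target space `ℂᴺ` (the orthogonal complement of their sum carries the
component `0`). Only the span of the `z^{⊗ m}` is embedded, so that repeated coordinates of
`z^{⊗ m}` may but need not be listed separately. -/
def IsOrthogonalSumOfTensorProducts {n N : ℕ} (g : Ball n → Ball N) : Prop :=
  ∃ (S : Finset ℕ) (c : ℕ → ℂ)
    (V : ∀ m : S, symTensors n m →ₗᵢ[ℂ] EuclideanSpace ℂ (Fin N)),
    (∀ m ∈ S, 1 ≤ m) ∧
    (∀ m k : S, m ≠ k → ∀ u v, inner ℂ (V m u) (V k v) = 0) ∧
    ∀ z : Ball n, (g z : EuclideanSpace ℂ (Fin N))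
      = ∑ m : S, c m • V m (symPow m (z : EuclideanSpace ℂ (Fin n)))

/-- `f` is a linear fractional transformation `z ↦ (A z + b) / (ℓ z + d)`, where `A` and `ℓ` are
linear and the denominator has no zero on the ball. -/
def IsLinearFractional {n N : ℕ} (f : Ball n → Ball N) : Prop :=
  ∃ (A : EuclideanSpace ℂ (Fin n) →ₗ[ℂ] EuclideanSpace ℂ (Fin N))
    (b : EuclideanSpace ℂ (Fin N)) (ℓ : EuclideanSpace ℂ (Fin n) →ₗ[ℂ] ℂ) (d : ℂ),
    ∀ z : Ball n, ℓ z + d ≠ 0 ∧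
      (f z : EuclideanSpace ℂ (Fin N)) = (ℓ z + d)⁻¹ • (A z + b)

end

end BallMap

/-! Composing `f` with a Möbius involution of the target, and with the conjugating automorphism of
the source, one may assume `f 0 = 0`. If `γ ∈ Γ_f` fixes the origin, so does its partner `ψ`, and by
Cartan's theorem both are unitary (`Aut.exists_isometry`): `f (U z) = V (f z)`.

For a commuting group of such `U` (the scalars or the diagonal torus) the operators `V` commute on
the span of the image of `f`. There they are simultaneously diagonalisable with orthogonal joint
eigenspaces, so `f` is a finite orthogonal sum of parts that transform by characters
(`exists_joint_eigen_decomposition`). Holomorphy forces a character of the circle to be a power, so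
scalar equivariance gives homogeneous parts `Q m` and torus equivariance gives monomials times fixed
orthogonal vectors. For (i), an orthonormal basis adapted to these vectors makes every coordinate a
monomial.

For (ii), the kernel `⟨Q m z, Q m w⟩` is unitarily invariant. Rotations fixing `w` show that it is a
positive multiple of `⟨z, w⟩ ^ m`, which is the Gram kernel of the tensor powers, and equal Gram
kernels are related by an isometry.

For (iii), if all of `Γ_f` fixed the origin, it would be the continuous image of a compact set of
pairs of isometries. Hence some `γ` moves the origin. Put `a = γ⁻¹ 0` and `b = f a`, and let `d` be
the top degree. If `d ≥ 2`, clearing denominators in `f ∘ γ = ψ ∘ f` on generic lines yields `1 -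
⟨b, f w⟩ = (1 - ⟨a, w⟩) ^ d`. The linear terms, taken to the limit `w = a`, give `‖Q 1 a‖² = d
‖a‖²`, against the Schwarz bound `‖Q 1 a‖ ≤ ‖a‖`. So the normalised map is linear, and undoing the
Möbius involution makes `f` linear fractional. -/

namespace BallMap

noncomputable section

/-! ### Automorphisms of the ball -/

/-- The complex Euclidean space `ℂⁿ`. -/
abbrev Cn (n : ℕ) : Type := EuclideanSpace ℂ (Fin n)

/-- The number `√(1 - ‖a‖²)`. -/
def defect {n : ℕ} (a : Cn n) : ℝ := Real.sqrt (1 - ‖a‖ ^ 2)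

theorem defect_nonneg {n : ℕ} (a : Cn n) : 0 ≤ defect a := Real.sqrt_nonneg _

theorem defect_sq {n : ℕ} {a : Cn n} (ha : ‖a‖ < 1) : defect a ^ 2 = 1 - ‖a‖ ^ 2 := by
  refine Real.sq_sqrt ?_
  nlinarith [norm_nonneg a]

theorem defect_pos {n : ℕ} {a : Cn n} (ha : ‖a‖ < 1) : 0 < defect a := by
  refine Real.sqrt_pos.2 ?_
  nlinarith [norm_nonneg a]

/-- The numerator of the Möbius involution of the ball that exchanges `0` and `a`. -/
def mobiusNum {n : ℕ} (a z : Cn n) : Cn n :=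
  (1 - inner ℂ a z / (1 + (defect a : ℂ))) • a - (defect a : ℂ) • z

/-- The Möbius involution of the ball that exchanges `0` and `a`. -/
def mobiusFun {n : ℕ} (a z : Cn n) : Cn n := (1 - inner ℂ a z)⁻¹ • mobiusNum a z

theorem one_add_defect_ne_zero {n : ℕ} (a : Cn n) : (1 + (defect a : ℂ)) ≠ 0 := by
  have h := defect_nonneg a
  have : (1 + defect a : ℝ) ≠ 0 := by positivity
  exact_mod_cast this

theorem norm_inner_lt_one {n : ℕ} {a z : Cn n} (ha : ‖a‖ < 1) (hz : ‖z‖ < 1) :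
    ‖inner ℂ a z‖ < 1 :=
  (norm_inner_le_norm a z).trans_lt
    (mul_lt_one_of_nonneg_of_lt_one_left (norm_nonneg _) ha hz.le)

theorem one_sub_inner_ne_zero {n : ℕ} {a z : Cn n} (ha : ‖a‖ < 1) (hz : ‖z‖ < 1) :
    1 - inner ℂ a z ≠ 0 := by
  intro h
  have h1 : inner ℂ a z = (1 : ℂ) := (sub_eq_zero.1 h).symm
  have h2 := norm_inner_lt_one ha hz
  rw [h1, norm_one] at h2
  exact lt_irrefl _ h2

/-- This identity is why the involution preserves the ball. The numerator is the usual `a - P z - s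
(z - P z)`, with `P` the projection to the line of `a` and `s` the defect, rewritten by `‖a‖² = (1 -
s)(1 + s)` so that `a = 0` needs no separate case. -/
theorem norm_mobiusNum_sq {n : ℕ} {a : Cn n} (ha : ‖a‖ < 1) (z : Cn n) :
    ‖mobiusNum a z‖ ^ 2
      = ‖1 - inner ℂ a z‖ ^ 2 - defect a ^ 2 * (1 - ‖z‖ ^ 2) := by
  have hs := defect_sq ha
  have hs0 := defect_nonneg a
  have ha2 : ‖a‖ ^ 2 = 1 - defect a ^ 2 := by linarith
  rw [mobiusNum, @norm_sub_sq ℂ, inner_smul_left, inner_smul_right, norm_smul, norm_smul,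
    mul_pow, mul_pow, ha2]
  generalize inner ℂ a z = t
  generalize defect a = s at *
  have hs1 : (1 + s) ≠ 0 := by positivity
  -- In terms of the real and imaginary parts of `1 - t / (1 + s)` the identity becomes polynomial.
  obtain ⟨p, hp⟩ : ∃ p : ℝ, p = 1 - t.re / (1 + s) := ⟨_, rfl⟩
  obtain ⟨q, hq⟩ : ∃ q : ℝ, q = -t.im / (1 + s) := ⟨_, rfl⟩
  have h1 : (1 - t / (1 + (s : ℂ))) = (p : ℂ) + (q : ℂ) * Complex.I := by
    have : (1 + (s : ℂ)) ≠ 0 := by exact_mod_cast hs1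
    conv_lhs => rw [← Complex.re_add_im t]
    rw [hp, hq]
    push_cast
    field_simp
    ring
  have hre : t.re = (1 + s) * (1 - p) := by rw [hp]; field_simp; ring
  have him : t.im = -((1 + s) * q) := by rw [hq]; field_simp
  have h2 : ‖(s : ℂ)‖ ^ 2 = s ^ 2 := by simp
  rw [h2, h1, Complex.sq_norm, Complex.sq_norm, Complex.normSq_add_mul_I, Complex.normSq_apply]
  simp [hre, him]
  ring

theorem norm_mobiusFun_lt_one {n : ℕ} {a z : Cn n} (ha : ‖a‖ < 1) (hz : ‖z‖ < 1) :
    ‖mobiusFun a z‖ < 1 := by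
  have h0 : 0 < ‖1 - inner ℂ a z‖ := norm_pos_iff.2 (one_sub_inner_ne_zero ha hz)
  rw [mobiusFun, norm_smul, norm_inv, inv_mul_lt_one₀ h0]
  refine lt_of_pow_lt_pow_left₀ 2 h0.le ?_
  rw [norm_mobiusNum_sq ha]
  have h1 : 0 < defect a ^ 2 := pow_pos (defect_pos ha) 2
  have h2 : 0 < 1 - ‖z‖ ^ 2 := by nlinarith [norm_nonneg z]
  nlinarith [mul_pos h1 h2]

theorem inner_mobiusNum {n : ℕ} {a : Cn n} (ha : ‖a‖ < 1) (z : Cn n) :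
    inner ℂ a (mobiusNum a z) = 1 - (defect a : ℂ) ^ 2 - inner ℂ a z := by
  have hs := defect_sq ha
  have h1 : inner ℂ a a = 1 - (defect a : ℂ) ^ 2 := by
    rw [inner_self_eq_norm_sq_to_K]
    have : ((‖a‖ ^ 2 : ℝ) : ℂ) = ((1 - defect a ^ 2 : ℝ) : ℂ) := by
      rw [hs, sub_sub_cancel]
    push_cast at this
    exact this
  rw [mobiusNum, inner_sub_right, inner_smul_right, inner_smul_right, h1]
  have := one_add_defect_ne_zero a
  field_simp
  ring

theorem mobiusFun_mobiusFun {n : ℕ} {a z : Cn n} (ha : ‖a‖ < 1) (hz : ‖z‖ < 1) :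
    mobiusFun a (mobiusFun a z) = z := by
  have h0 := one_sub_inner_ne_zero ha hz
  have h1 := one_add_defect_ne_zero a
  have hs : (defect a : ℂ) ≠ 0 := by exact_mod_cast (defect_pos ha).ne'
  have h2 : 1 - inner ℂ a (mobiusFun a z) = (defect a : ℂ) ^ 2 / (1 - inner ℂ a z) := by
    rw [mobiusFun, inner_smul_right, inner_mobiusNum ha]
    field_simp
    ring
  have h3 : inner ℂ a (mobiusFun a z) = 1 - (defect a : ℂ) ^ 2 / (1 - inner ℂ a z) := by
    rw [← h2]; ring
  conv_lhs => rw [mobiusFun, mobiusNum]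
  rw [h2, h3, mobiusFun, mobiusNum]
  generalize inner ℂ a z = t at *
  generalize (defect a : ℂ) = s at *
  rw [smul_sub, smul_sub, smul_sub, smul_sub, smul_smul, smul_smul, smul_smul, smul_smul, smul_smul,
    smul_smul, ← sub_add, ← sub_smul]
  -- The image is a combination of `a` and `z`: `e1` says that the coefficient of `a` vanishes, `e2`
  -- that the coefficient of `z` is one.
  have e1 : (s ^ 2 / (1 - t))⁻¹ * (1 - (1 - s ^ 2 / (1 - t)) / (1 + s)) -
      (s ^ 2 / (1 - t))⁻¹ * (s * ((1 - t)⁻¹ * (1 - t / (1 + s)))) = 0 := by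
    field_simp
    ring
  have e2 : (s ^ 2 / (1 - t))⁻¹ * (s * ((1 - t)⁻¹ * s)) = 1 := by
    field_simp
  simp only [mul_assoc] at e1 e2 ⊢
  rw [e1, zero_smul, zero_add, smul_smul]
  simp only [mul_assoc]
  rw [e2, one_smul]

theorem mobiusFun_zero {n : ℕ} (a : Cn n) : mobiusFun a 0 = a := by
  simp [mobiusFun, mobiusNum]

theorem mobiusFun_self {n : ℕ} {a : Cn n} (ha : ‖a‖ < 1) : mobiusFun a a = 0 := by
  have := mobiusFun_mobiusFun (a := a) (z := 0) ha (by simp)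
  rwa [mobiusFun_zero] at this

theorem differentiable_mobiusNum {n : ℕ} (a : Cn n) : Differentiable ℂ (mobiusNum a) := by
  have h : Differentiable ℂ fun z : Cn n => inner ℂ a z := (innerSL ℂ a).differentiable
  unfold mobiusNum
  fun_prop

theorem differentiableOn_mobiusFun {n : ℕ} {a : Cn n} (ha : ‖a‖ < 1) :
    DifferentiableOn ℂ (mobiusFun a) (Metric.ball 0 1) := by
  have h : Differentiable ℂ fun z : Cn n => inner ℂ a z := (innerSL ℂ a).differentiable
  refine DifferentiableOn.fun_smul (DifferentiableOn.fun_inv ?_ ?_)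
    (differentiable_mobiusNum a).differentiableOn
  · fun_prop
  · exact fun z hz => one_sub_inner_ne_zero ha (mem_ball_zero_iff.1 hz)

theorem Ball.norm_lt {n : ℕ} (z : Ball n) : ‖(z : Cn n)‖ < 1 := mem_ball_zero_iff.1 z.2

/-- The origin of the ball. -/
def Ball.origin (n : ℕ) : Ball n := ⟨0, by simp⟩

/-- The Möbius involution as an automorphism of the ball. -/
def mobius {n : ℕ} (a : Ball n) : Aut n :=
  ⟨{ toFun := fun z => ⟨mobiusFun a z, mem_ball_zero_iff.2 (norm_mobiusFun_lt_one a.norm_lt z.norm_lt)⟩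
     invFun := fun z => ⟨mobiusFun a z, mem_ball_zero_iff.2 (norm_mobiusFun_lt_one a.norm_lt z.norm_lt)⟩
     left_inv := fun z => Subtype.ext (mobiusFun_mobiusFun a.norm_lt z.norm_lt)
     right_inv := fun z => Subtype.ext (mobiusFun_mobiusFun a.norm_lt z.norm_lt) },
    ⟨mobiusFun a, differentiableOn_mobiusFun a.norm_lt, fun _ => rfl⟩,
    ⟨mobiusFun a, differentiableOn_mobiusFun a.norm_lt, fun _ => rfl⟩⟩

theorem mobius_apply {n : ℕ} (a z : Ball n) :
    ((mobius a).toFun z : Cn n) = mobiusFun (a : Cn n) z := rfl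

theorem mobius_origin {n : ℕ} (a : Ball n) : (mobius a).toFun (Ball.origin n) = a :=
  Subtype.ext (mobiusFun_zero _)

theorem mobius_self {n : ℕ} (a : Ball n) : (mobius a).toFun a = Ball.origin n :=
  Subtype.ext (mobiusFun_self a.norm_lt)

theorem mobius_mobius {n : ℕ} (a z : Ball n) : (mobius a).toFun ((mobius a).toFun z) = z :=
  Subtype.ext (mobiusFun_mobiusFun a.norm_lt z.norm_lt)

theorem Aut.mul_toFun {n : ℕ} (γ δ : Aut n) (z : Ball n) :
    (γ * δ).toFun z = γ.toFun (δ.toFun z) := rfl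

theorem Aut.inv_toFun_toFun {n : ℕ} (γ : Aut n) (z : Ball n) : γ⁻¹.toFun (γ.toFun z) = z :=
  Equiv.symm_apply_apply γ.1 z

theorem Aut.toFun_inv_toFun {n : ℕ} (γ : Aut n) (z : Ball n) : γ.toFun (γ⁻¹.toFun z) = z :=
  Equiv.apply_symm_apply γ.1 z

theorem Aut.ext {n : ℕ} {γ δ : Aut n} (h : ∀ z, γ.toFun z = δ.toFun z) : γ = δ :=
  Subtype.ext (Equiv.ext h)

theorem Aut.isHolomorphic {n : ℕ} (γ : Aut n) : IsHolomorphic γ.toFun := γ.2.1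

theorem isometryToAut_apply {n : ℕ} (L : Cn n ≃ₗᵢ[ℂ] Cn n) (z : Ball n) :
    ((isometryToAut n L).toFun z : Cn n) = L z := rfl

/-! ### Schwarz lemma and the stabiliser of the origin -/

theorem norm_le_of_isHolomorphic {n m : ℕ} {f : Ball n → Ball m} (hf : IsHolomorphic f)
    (h0 : f (Ball.origin n) = Ball.origin m) (z : Ball n) : ‖(f z : Cn m)‖ ≤ ‖(z : Cn n)‖ := by
  obtain ⟨F, hF, hFf⟩ := hf
  have hF0 : F 0 = 0 := by
    have := hFf (Ball.origin n)
    rw [h0] at this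
    exact this
  have := Complex.dist_le_div_mul_dist_of_mapsTo_ball (f := F) (c := 0) (R₁ := 1) (R₂ := 1)
    (z := z) hF ?_ z.2
  · rw [hF0, hFf] at this
    simpa using this
  · intro w hw
    rw [hFf ⟨w, hw⟩, hF0]
    exact Metric.ball_subset_closedBall (f ⟨w, hw⟩).2

theorem exists_one_lt_mul_norm_lt_one {E : Type*} [NormedAddCommGroup E] {z : E} (hz : ‖z‖ < 1) :
    ∃ R : ℝ, 1 < R ∧ R * ‖z‖ < 1 := by
  rcases eq_or_ne z 0 with rfl | hz0
  · exact ⟨2, by norm_num, by simp⟩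
  · have hzp := norm_pos_iff.2 hz0
    obtain ⟨R, h1, h2⟩ := exists_between ((one_lt_inv₀ hzp).2 hz)
    refine ⟨R, h1, ?_⟩
    calc R * ‖z‖ < ‖z‖⁻¹ * ‖z‖ := by gcongr
      _ = 1 := inv_mul_cancel₀ hzp.ne'

/-- Carries identities between homogeneous maps from the ball to the whole space. -/
theorem exists_smul_eq_of_norm_lt_one {E : Type*} [NormedAddCommGroup E] [NormedSpace ℂ E] (z : E) :
    ∃ (c : ℂ) (z' : E), ‖z'‖ < 1 ∧ z = c • z' := by
  have hp : 0 < 1 + ‖z‖ := by positivity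
  have hc : ((1 + ‖z‖ : ℝ) : ℂ) ≠ 0 := by exact_mod_cast hp.ne'
  refine ⟨((1 + ‖z‖ : ℝ) : ℂ), ((1 + ‖z‖ : ℝ) : ℂ)⁻¹ • z, ?_, (smul_inv_smul₀ hc z).symm⟩
  rw [norm_smul, norm_inv, Complex.norm_real, Real.norm_of_nonneg hp.le, inv_mul_lt_one₀ hp]
  linarith

/-- Cartan's theorem. Schwarz for `γ` and `γ⁻¹` shows that norms are preserved, so on each complex
line `γ (t z) / t` has constant norm. By the maximum principle in a strictly convex space it is
constant, and `γ` agrees with its derivative at the origin. -/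
theorem Aut.exists_isometry {n : ℕ} (γ : Aut n) (h0 : γ.toFun (Ball.origin n) = Ball.origin n) :
    ∃ L : Cn n ≃ₗᵢ[ℂ] Cn n, γ = isometryToAut n L := by
  have hnorm : ∀ z : Ball n, ‖(γ.toFun z : Cn n)‖ = ‖(z : Cn n)‖ := by
    intro z
    refine le_antisymm (norm_le_of_isHolomorphic γ.isHolomorphic h0 z) ?_
    have h1 : γ⁻¹.toFun (Ball.origin n) = Ball.origin n := by
      conv_lhs => rw [← h0]
      exact γ.inv_toFun_toFun _
    have := norm_le_of_isHolomorphic γ⁻¹.isHolomorphic h1 (γ.toFun z)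
    rwa [γ.inv_toFun_toFun] at this
  obtain ⟨F, hF, hFf⟩ := γ.isHolomorphic
  have hF0 : F 0 = 0 := by
    have := hFf (Ball.origin n)
    rw [h0] at this
    exact this
  have hFn : ∀ z : Cn n, ‖z‖ < 1 → ‖F z‖ = ‖z‖ := fun z hz => by
    rw [hFf ⟨z, mem_ball_zero_iff.2 hz⟩, hnorm]
  have hd0 : DifferentiableAt ℂ F 0 := hF.differentiableAt (Metric.ball_mem_nhds _ one_pos)
  have key : ∀ z : Cn n, ‖z‖ < 1 → F z = fderiv ℂ F 0 z := by
    intro z hz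
    -- A radius above one makes `t = 1` an interior point of the slice.
    obtain ⟨R, hR1, hR⟩ := exists_one_lt_mul_norm_lt_one hz
    have hmaps : ∀ t ∈ Metric.ball (0 : ℂ) R, t • z ∈ Metric.ball (0 : Cn n) 1 := by
      intro t ht
      rw [mem_ball_zero_iff] at ht ⊢
      rw [norm_smul]
      nlinarith [norm_nonneg z]
    set g : ℂ → Cn n := fun t => F (t • z) with hg
    have hgd : DifferentiableOn ℂ g (Metric.ball 0 R) :=
      hF.comp (by fun_prop) hmaps
    have hsl : DifferentiableOn ℂ (dslope g 0) (Metric.ball 0 R) :=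
      (Complex.differentiableOn_dslope (Metric.ball_mem_nhds _ (by linarith))).2 hgd
    have hderiv : HasDerivAt g (fderiv ℂ F 0 z) 0 := by
      have h1 : HasFDerivAt F (fderiv ℂ F 0) ((0 : ℂ) • z) := by
        rw [zero_smul]; exact hd0.hasFDerivAt
      have h2 : HasDerivAt (fun t : ℂ => t • z) z 0 := by
        simpa using (hasDerivAt_id (0 : ℂ)).smul_const z
      exact h1.comp_hasDerivAt (0 : ℂ) h2
    have hsn : ∀ t ∈ Metric.ball (0 : ℂ) R, t ≠ 0 → ‖dslope g 0 t‖ = ‖z‖ := by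
      intro t ht h
      rw [dslope_of_ne _ h, slope_def_module, norm_smul]
      simp only [hg, sub_zero, zero_smul, hF0, norm_inv]
      rw [hFn _ (mem_ball_zero_iff.1 (hmaps t ht)), norm_smul,
        inv_mul_cancel_left₀ (norm_ne_zero_iff.2 h)]
    have h1R : (1 : ℂ) ∈ Metric.ball (0 : ℂ) R := by simpa using hR1
    have h0R : (0 : ℂ) ∈ Metric.ball (0 : ℂ) R := by simp; linarith
    have hs0 : ‖dslope g 0 0‖ = ‖z‖ := by
      have hc : ContinuousAt (fun t => ‖dslope g 0 t‖) 0 :=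
        (hsl.differentiableAt (Metric.ball_mem_nhds _ (by linarith))).continuousAt.norm
      have h3 : Filter.Tendsto (fun t => ‖dslope g 0 t‖) (nhdsWithin 0 {0}ᶜ) (nhds ‖z‖) := by
        refine tendsto_const_nhds.congr' ?_
        filter_upwards [self_mem_nhdsWithin, mem_nhdsWithin_of_mem_nhds
          (Metric.ball_mem_nhds (0 : ℂ) (by linarith : 0 < R))] with t ht ht'
        exact (hsn t ht' ht).symm
      exact tendsto_nhds_unique (hc.tendsto.mono_left nhdsWithin_le_nhds) h3
    have hmax : IsMaxOn (norm ∘ dslope g 0) (Metric.ball 0 R) 0 := by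
      intro t ht
      change ‖dslope g 0 t‖ ≤ ‖dslope g 0 0‖
      rw [hs0]
      rcases eq_or_ne t 0 with rfl | h
      · exact hs0.le
      · exact (hsn t ht h).le
    have h5 := Complex.eqOn_of_isPreconnected_of_isMaxOn_norm
      (convex_ball (0 : ℂ) R).isPreconnected Metric.isOpen_ball hsl h0R hmax h1R
    rw [Function.const_apply, dslope_same, hderiv.deriv, dslope_of_ne _ one_ne_zero,
      slope_def_module] at h5
    simpa [hg, hF0] using h5
  have hAn : ∀ z : Cn n, ‖fderiv ℂ F 0 z‖ = ‖z‖ := by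
    intro z
    have hpos : 0 < 1 + ‖z‖ := by positivity
    have hc : ((1 + ‖z‖ : ℝ) : ℂ) ≠ 0 := by exact_mod_cast hpos.ne'
    have hw : ‖((1 + ‖z‖ : ℝ) : ℂ)⁻¹ • z‖ < 1 := by
      rw [norm_smul, norm_inv, Complex.norm_real, Real.norm_of_nonneg hpos.le,
        inv_mul_lt_one₀ hpos]
      linarith
    have h1 := hFn _ hw
    rw [key _ hw, map_smul, norm_smul, norm_smul] at h1
    exact mul_left_cancel₀ (by simpa using hc) h1
  let A : Cn n →ₗᵢ[ℂ] Cn n := ⟨(fderiv ℂ F 0).toLinearMap, hAn⟩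
  refine ⟨A.toLinearIsometryEquiv rfl, Aut.ext fun z => Subtype.ext ?_⟩
  rw [← hFf, key z z.norm_lt]
  rfl

theorem Aut.exists_isometry_mul_mobius {n : ℕ} (γ : Aut n) (a : Ball n)
    (ha : γ.toFun a = Ball.origin n) :
    ∃ L : Cn n ≃ₗᵢ[ℂ] Cn n, γ = isometryToAut n L * mobius a := by
  obtain ⟨L, hL⟩ := (γ * mobius a).exists_isometry (by
    rw [Aut.mul_toFun, mobius_origin, ha])
  refine ⟨L, Aut.ext fun z => ?_⟩
  rw [← hL, Aut.mul_toFun, Aut.mul_toFun, mobius_mobius]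

theorem exists_unitaryToAut_eq {n : ℕ} (L : Cn n ≃ₗᵢ[ℂ] Cn n) :
    ∃ U : Matrix.unitaryGroup (Fin n) ℂ, unitaryToAut n U = isometryToAut n L := by
  set u := Unitary.linearIsometryEquiv.symm L with hu
  let e := Matrix.toEuclideanCLM (n := Fin n) (𝕜 := ℂ)
  have he : e (e.symm u.1) = u.1 := e.apply_symm_apply u.1
  have hs : e (star (e.symm u.1)) = star u.1 := by rw [map_star, he]
  have hmem : e.symm u.1 ∈ Matrix.unitaryGroup (Fin n) ℂ := by
    refine ⟨e.injective ?_, e.injective ?_⟩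
    · change e (star (e.symm u.1) * e.symm u.1) = e 1
      rw [map_mul, hs, he, map_one]; exact u.2.1
    · change e (e.symm u.1 * star (e.symm u.1)) = e 1
      rw [map_mul, hs, he, map_one]; exact u.2.2
  refine ⟨⟨e.symm u.1, hmem⟩, ?_⟩
  have h : unitaryToOperator n ⟨e.symm u.1, hmem⟩ = u := Subtype.ext he
  have h2 : Unitary.linearIsometryEquiv u = L := Unitary.linearIsometryEquiv.apply_symm_apply L
  change isometryToAut n (Unitary.linearIsometryEquiv (unitaryToOperator n _)) = _
  rw [h, h2]

theorem exists_isometryToAut_eq {n : ℕ} (U : Matrix.unitaryGroup (Fin n) ℂ) :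
    ∃ L : Cn n ≃ₗᵢ[ℂ] Cn n, unitaryToAut n U = isometryToAut n L :=
  ⟨_, rfl⟩

/-! ### Joint eigenspaces of commuting isometries -/

/-- By dimension, an isometry maps an invariant subspace onto itself, hence also preserves its
orthogonal complement. -/
theorem isSemisimple_of_isometry {W : Type*} [NormedAddCommGroup W] [InnerProductSpace ℂ W]
    [FiniteDimensional ℂ W] (T : W →ₗᵢ[ℂ] W) :
    Module.End.IsSemisimple (T.toLinearMap : Module.End ℂ W) := by
  refine Module.End.isSemisimple_iff.2 fun p hp =>
    ⟨pᗮ, ?_, p.isCompl_orthogonal⟩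
  have hmap : p.map T.toLinearMap = p := by
    refine Submodule.eq_of_le_of_finrank_eq (Submodule.map_le_iff_le_comap.2 hp) ?_
    exact (Submodule.equivMapOfInjective T.toLinearMap T.injective p).finrank_eq.symm
  rw [Module.End.mem_invtSubmodule]
  intro v hv
  rw [Submodule.mem_comap, Submodule.mem_orthogonal]
  intro u hu
  rw [← hmap] at hu
  obtain ⟨u', hu', rfl⟩ := hu
  change inner ℂ (T u') (T v) = 0
  rw [T.inner_map_map]
  exact (Submodule.mem_orthogonal p v).1 hv u' hu'

/-- Over `ℂ` the joint generalised eigenspaces of a commuting family span, and semisimplicity turns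
them into eigenspaces. -/
theorem iSup_iInf_eigenspace_eq_top_of_isometry {W : Type*} [NormedAddCommGroup W]
    [InnerProductSpace ℂ W] [FiniteDimensional ℂ W] {G : Type*} (T : G → W →ₗᵢ[ℂ] W)
    (hT : ∀ g h w, T g (T h w) = T h (T g w)) :
    ⨆ χ : G → ℂ, ⨅ g, Module.End.eigenspace ((T g).toLinearMap : Module.End ℂ W) (χ g) = ⊤ := by
  have hs : ∀ g, Module.End.IsFinitelySemisimple ((T g).toLinearMap : Module.End ℂ W) :=
    fun g => Module.End.isFinitelySemisimple_iff_isSemisimple.2 (isSemisimple_of_isometry (T g))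
  have := Module.End.iSup_iInf_maxGenEigenspace_eq_top_of_iSup_maxGenEigenspace_eq_top_of_commute
    (fun g => ((T g).toLinearMap : Module.End ℂ W))
    (fun g h _ => LinearMap.ext fun w => hT g h w)
    (fun g => Module.End.iSup_maxGenEigenspace_eq_top _)
  simpa only [fun g (χ : G → ℂ) => (hs g).maxGenEigenspace_eq_eigenspace (χ g)] using this

/-- An eigenvalue `a` of an isometry has modulus one, so `⟨u, v⟩ = conj a * b * ⟨u, v⟩` with `⟨u, v⟩
≠ 0` would force `a = b`. -/
theorem inner_eq_zero_of_isometry_eigenvectors {H : Type*} [NormedAddCommGroup H]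
    [InnerProductSpace ℂ H] (T : H →ₗᵢ[ℂ] H) {a b : ℂ} (hab : a ≠ b) {u v : H}
    (hu : T u = a • u) (hv : T v = b • v) : inner ℂ u v = 0 := by
  rcases eq_or_ne u 0 with rfl | hu0
  · exact inner_zero_left _
  have h1 : inner ℂ u v = starRingEnd ℂ a * b * inner ℂ u v := by
    conv_lhs => rw [← T.inner_map_map u v, hu, hv, inner_smul_left, inner_smul_right, ← mul_assoc]
  have ha : ‖a‖ = 1 := by
    have h2 := T.norm_map u
    rw [hu, norm_smul] at h2
    exact (mul_eq_right₀ (norm_ne_zero_iff.2 hu0)).1 h2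
  by_contra hne
  have h3 : starRingEnd ℂ a * b = 1 := (mul_eq_right₀ hne).1 h1.symm
  have h4 : a * starRingEnd ℂ a = 1 := by
    rw [Complex.mul_conj, Complex.normSq_eq_norm_sq, ha]
    norm_num
  apply hab
  calc a = a * (starRingEnd ℂ a * b) := by rw [h3, mul_one]
    _ = b := by rw [← mul_assoc, h4, one_mul]

/-- A map into a finite-dimensional Hilbert space that intertwines a commuting family of
transformations with isometries is a finite sum of mutually orthogonal projections of itself, on
each of which the transformations act by scalars. -/
theorem exists_joint_eigen_decomposition {X G H : Type*} [NormedAddCommGroup H]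
    [InnerProductSpace ℂ H] [FiniteDimensional ℂ H] (f : X → H) (act : G → X → X)
    (hact : ∀ g h x, act g (act h x) = act h (act g x)) (V : G → H →ₗᵢ[ℂ] H)
    (hV : ∀ g x, f (act g x) = V g (f x)) :
    ∃ (I : Finset (G → ℂ)) (P : (G → ℂ) → H →L[ℂ] H),
      (∀ χ ∈ I, ∃ x, P χ (f x) ≠ 0) ∧ (∀ x, f x = ∑ χ ∈ I, P χ (f x)) ∧
      (∀ χ χ', χ ≠ χ' → ∀ u v, inner ℂ (P χ u) (P χ' v) = 0) ∧
      ∀ χ g x, P χ (f (act g x)) = χ g • P χ (f x) := by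
  classical
  -- Commutation of the `V g` follows from that of the action only on the span of the image, so the
  -- diagonalisation takes place there.
  set W : Submodule ℂ H := Submodule.span ℂ (Set.range f) with hW
  have hfW : ∀ x, f x ∈ W := fun x => Submodule.subset_span (Set.mem_range_self x)
  have hVW : ∀ g, ∀ w ∈ W, V g w ∈ W := by
    intro g w hw
    refine (Submodule.span_le (p := W.comap (V g).toLinearMap)).2 ?_ hw
    rintro _ ⟨x, rfl⟩
    change V g (f x) ∈ W
    rw [← hV]
    exact hfW _
  have hcomm : ∀ g h, ∀ w ∈ W, V g (V h w) = V h (V g w) := by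
    intro g h w hw
    have : W ≤ LinearMap.eqLocus ((V g).toLinearMap ∘ₗ (V h).toLinearMap)
        ((V h).toLinearMap ∘ₗ (V g).toLinearMap) := by
      refine Submodule.span_le.2 ?_
      rintro _ ⟨x, rfl⟩
      change V g (V h (f x)) = V h (V g (f x))
      rw [← hV, ← hV, ← hV, ← hV, hact]
    exact this hw
  let T : G → W →ₗᵢ[ℂ] W := fun g =>
    ⟨(V g).toLinearMap.restrict (hVW g), fun w => (V g).norm_map w⟩
  set E : (G → ℂ) → Submodule ℂ H := fun χ =>
    (⨅ g, Module.End.eigenspace ((T g).toLinearMap : Module.End ℂ W) (χ g)).map W.subtype with hE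
  have hEW : ⨆ χ, E χ = W := by
    rw [hE, ← Submodule.map_iSup, iSup_iInf_eigenspace_eq_top_of_isometry T
      (fun g h w => Subtype.ext (hcomm g h w w.2)), Submodule.map_top, Submodule.range_subtype]
  have hEV : ∀ χ, ∀ v ∈ E χ, ∀ g, V g v = χ g • v := by
    rintro χ _ ⟨w, hw, rfl⟩ g
    have h1 := (Submodule.mem_iInf _).1 hw g
    exact congrArg Subtype.val (Module.End.mem_eigenspace_iff.1 h1)
  have horth : ∀ χ χ', χ ≠ χ' → ∀ u ∈ E χ, ∀ v ∈ E χ', inner ℂ u v = 0 := by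
    intro χ χ' h u hu v hv
    obtain ⟨g, hg⟩ := Function.ne_iff.1 h
    exact inner_eq_zero_of_isometry_eigenvectors (V g) hg (hEV χ u hu g) (hEV χ' v hv g)
  have hfam : OrthogonalFamily ℂ (fun χ => E χ) fun χ => (E χ).subtypeₗᵢ :=
    OrthogonalFamily.of_pairwise fun χ χ' h u hu v hv =>
      inner_eq_zero_symm.1 (horth χ χ' h u hu v hv)
  have hfin : {χ | E χ ≠ ⊥}.Finite := WellFoundedGT.finite_ne_bot_of_iSupIndep hfam.independent
  set P : (G → ℂ) → H →L[ℂ] H := fun χ => (E χ).starProjection with hP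
  have hPmem : ∀ χ v, P χ v ∈ E χ := fun χ v => (E χ).starProjection_apply_mem v
  have hPself : ∀ χ, ∀ v ∈ E χ, P χ v = v := fun χ v hv =>
    Submodule.starProjection_eq_self_iff.2 hv
  have hPother : ∀ χ χ', χ ≠ χ' → ∀ v ∈ E χ', P χ v = 0 := fun χ χ' h v hv =>
    (Submodule.starProjection_apply_eq_zero_iff _).2
      ((Submodule.mem_orthogonal _ _).2 fun u hu => horth χ χ' h u hu v hv)
  have hPV : ∀ χ g, ∀ w ∈ W, P χ (V g w) = χ g • P χ w := by
    intro χ g w hw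
    rw [← hEW] at hw
    refine Submodule.iSup_induction E (motive := fun w => P χ (V g w) = χ g • P χ w) hw ?_ ?_ ?_
    · intro χ' v hv
      rw [hEV χ' v hv, map_smul]
      rcases eq_or_ne χ χ' with rfl | h
      · rfl
      · rw [hPother χ χ' h v hv, smul_zero, smul_zero]
    · simp
    · intro x y hx hy
      rw [map_add, map_add, map_add, hx, hy, smul_add]
  have hsum : ∀ w ∈ W, w = ∑ χ ∈ hfin.toFinset, P χ w := by
    intro w hw
    rw [← hEW] at hw
    refine Submodule.iSup_induction E (motive := fun w => w = ∑ χ ∈ hfin.toFinset, P χ w) hw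
      ?_ ?_ ?_
    · intro χ' v hv
      rcases eq_or_ne v 0 with rfl | hv0
      · simp
      have hmem : χ' ∈ hfin.toFinset := by
        rw [Set.Finite.mem_toFinset]
        exact fun h => hv0 ((Submodule.eq_bot_iff _).1 h v hv)
      rw [Finset.sum_eq_single_of_mem χ' hmem fun χ _ h => hPother χ χ' h v hv, hPself χ' v hv]
    · simp
    · intro x y hx hy
      conv_lhs => rw [hx, hy]
      simp only [map_add, Finset.sum_add_distrib]
  -- Characters whose component vanishes identically are discarded, since a nonzero value is what
  -- later forces the character to be a power.
  refine ⟨hfin.toFinset.filter fun χ => ∃ x, P χ (f x) ≠ 0, P, ?_, ?_, ?_, ?_⟩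
  · exact fun χ hχ => (Finset.mem_filter.1 hχ).2
  · intro x
    rw [Finset.sum_filter_of_ne fun χ _ h => ⟨x, h⟩]
    exact hsum _ (hfW x)
  · exact fun χ χ' h u v => horth χ χ' h _ (hPmem χ u) _ (hPmem χ' v)
  · intro χ g x
    rw [hV, hPV χ g _ (hfW x)]

/-! ### Homogeneous components -/

/-- A holomorphic function on a disc on which rotations act by a character that is not
identically zero: the character is a power. -/
theorem exists_eq_pow_of_rotation {H : Type*} [NormedAddCommGroup H] [NormedSpace ℂ H]
    [CompleteSpace H] {g : ℂ → H} {R : ℝ} (hR : 0 < R)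
    (hg : DifferentiableOn ℂ g (Metric.ball 0 R)) {χ : Circle → ℂ}
    (hχ : ∀ t : Circle, ∀ l : ℂ, ‖l‖ < R → g (t * l) = χ t • g l)
    (hne : ∃ l : ℂ, ‖l‖ < R ∧ g l ≠ 0) : ∃ k : ℕ, ∀ t : Circle, χ t = (t : ℂ) ^ k := by
  have han : AnalyticOnNhd ℂ g (Metric.ball 0 R) := hg.analyticOnNhd Metric.isOpen_ball
  have h0 : (0 : ℂ) ∈ Metric.ball (0 : ℂ) R := Metric.mem_ball_self hR
  have hnz : ¬ ∀ᶠ z in nhds (0 : ℂ), g z = 0 := by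
    intro h
    obtain ⟨l, hl, hgl⟩ := hne
    exact hgl (han.eqOn_zero_of_preconnected_of_eventuallyEq_zero
      (convex_ball (0 : ℂ) R).isPreconnected h0 h (mem_ball_zero_iff.2 hl))
  -- The exponent is the order of vanishing at `0`; comparing the leading coefficients `h 0`
  -- identifies the character.
  obtain ⟨k, h, hh, hh0, hgh⟩ := (han 0 h0).exists_eventuallyEq_pow_smul_nonzero_iff.2 hnz
  refine ⟨k, fun t => ?_⟩
  have ht : Filter.Tendsto (fun l : ℂ => (t : ℂ) * l) (nhds 0) (nhds 0) := by
    have : Continuous fun l : ℂ => (t : ℂ) * l := by fun_prop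
    simpa using this.tendsto 0
  have hev : ∀ᶠ l in nhdsWithin (0 : ℂ) {0}ᶜ, (t : ℂ) ^ k • h (t * l) = χ t • h l := by
    filter_upwards [nhdsWithin_le_nhds hgh, nhdsWithin_le_nhds (ht.eventually hgh),
      nhdsWithin_le_nhds (Metric.ball_mem_nhds (0 : ℂ) hR), self_mem_nhdsWithin]
      with l h1 h2 h3 h4
    have h5 := hχ t l (mem_ball_zero_iff.1 h3)
    rw [h1, h2, sub_zero, sub_zero, mul_pow, smul_comm (χ t), mul_comm, mul_smul] at h5
    exact smul_right_injective H (pow_ne_zero k h4) h5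
  have hl1 : Filter.Tendsto (fun l => (t : ℂ) ^ k • h (t * l)) (nhdsWithin (0 : ℂ) {0}ᶜ)
      (nhds ((t : ℂ) ^ k • h 0)) :=
    ((hh.continuousAt.tendsto.comp ht).const_smul _).mono_left nhdsWithin_le_nhds
  have hl2 : Filter.Tendsto (fun l => χ t • h l) (nhdsWithin (0 : ℂ) {0}ᶜ) (nhds (χ t • h 0)) :=
    (hh.continuousAt.tendsto.const_smul _).mono_left nhdsWithin_le_nhds
  exact (smul_left_injective ℂ hh0 (tendsto_nhds_unique_of_eventuallyEq hl1 hl2 hev)).symm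

/-- A holomorphic function on a disc on which rotations act by a power is a monomial. -/
theorem eq_pow_smul_of_rotation {H : Type*} [NormedAddCommGroup H] [NormedSpace ℂ H]
    {g : ℂ → H} {R : ℝ} (hR : 1 < R)
    (hg : DifferentiableOn ℂ g (Metric.ball 0 R)) {k : ℕ}
    (hk : ∀ t : Circle, ∀ l : ℂ, ‖l‖ < R → g (t * l) = (t : ℂ) ^ k • g l) {l : ℂ}
    (hl : ‖l‖ < R) : g l = l ^ k • g 1 := by
  -- Equivariance gives equality on the circle of radius `r`, and the maximum principle extends it
  -- to the disc. Using it for `l` and for `1` eliminates `g r`.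
  have key : ∀ r : ℝ, 0 < r → r < R → ∀ l : ℂ, ‖l‖ ≤ r →
      (r : ℂ) ^ k • g l = l ^ k • g r := by
    intro r hr hrR l hl
    have hsub : closure (Metric.ball (0 : ℂ) r) ⊆ Metric.ball 0 R := by
      rw [closure_ball _ hr.ne']
      exact Metric.closedBall_subset_ball hrR
    have hd : DiffContOnCl ℂ (fun l => (r : ℂ) ^ k • g l) (Metric.ball 0 r) :=
      ((hg.const_smul _).mono hsub).diffContOnCl
    have hd2 : DiffContOnCl ℂ (fun l : ℂ => l ^ k • g r) (Metric.ball 0 r) := by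
      have : Differentiable ℂ fun l : ℂ => l ^ k • g r := by fun_prop
      exact this.diffContOnCl
    have hfr : Set.EqOn (fun l => (r : ℂ) ^ k • g l) (fun l : ℂ => l ^ k • g r)
        (frontier (Metric.ball 0 r)) := by
      intro w hw
      rw [frontier_ball _ hr.ne', mem_sphere_zero_iff_norm] at hw
      have hr0 : (r : ℂ) ≠ 0 := by exact_mod_cast hr.ne'
      let t : Circle := ⟨w / r, by
        rw [Submonoid.unitSphere, Submonoid.mem_mk, Subsemigroup.mem_mk, mem_sphere_zero_iff_norm,
          norm_div, hw, Complex.norm_real, Real.norm_of_nonneg hr.le,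
          div_self hr.ne']⟩
      have h1 := hk t r (by rwa [Complex.norm_real, Real.norm_of_nonneg hr.le])
      have h2 : (t : ℂ) * r = w := div_mul_cancel₀ w hr0
      rw [h2] at h1
      change (r : ℂ) ^ k • g w = w ^ k • g r
      rw [h1, smul_smul, ← mul_pow, mul_comm, h2]
    refine Complex.eqOn_closure_of_eqOn_frontier Metric.isBounded_ball hd hd2 hfr ?_
    rw [closure_ball _ hr.ne']
    exact mem_closedBall_zero_iff.2 hl
  set r : ℝ := max 1 ‖l‖
  have hr0 : 0 < r := lt_max_of_lt_left one_pos
  have h1 := key r hr0 (max_lt hR hl) l (le_max_right _ _)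
  have h2 := key r hr0 (max_lt hR hl) 1 (by rw [norm_one]; exact le_max_left _ _)
  rw [one_pow, one_smul] at h2
  rw [← h2, smul_comm] at h1
  exact smul_right_injective H (pow_ne_zero k (by exact_mod_cast hr0.ne' : (r : ℂ) ≠ 0)) h1

/-- A nonzero holomorphic function on the unit ball on which the circle acts by a character
extends to an entire homogeneous function. -/
theorem exists_homogeneous_extension {E H : Type*} [NormedAddCommGroup E] [NormedSpace ℂ E]
    [NormedAddCommGroup H] [NormedSpace ℂ H] [CompleteSpace H] {g : E → H}
    (hg : DifferentiableOn ℂ g (Metric.ball 0 1)) {χ : Circle → ℂ}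
    (hχ : ∀ t : Circle, ∀ z : E, ‖z‖ < 1 → g ((t : ℂ) • z) = χ t • g z)
    (hne : ∃ z : E, ‖z‖ < 1 ∧ g z ≠ 0) :
    ∃ m : ℕ, (∀ t : Circle, χ t = (t : ℂ) ^ m) ∧ ∃ Q : E → H, Differentiable ℂ Q ∧
      (∀ (l : ℂ) (z : E), Q (l • z) = l ^ m • Q z) ∧ ∀ z : E, ‖z‖ < 1 → Q z = g z := by
  have hmaps : ∀ (z : E) (R : ℝ), 0 < R → R * ‖z‖ < 1 → ∀ l : ℂ, ‖l‖ < R → ‖l • z‖ < 1 := by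
    intro z R hR hRz l hl
    rw [norm_smul]
    nlinarith [norm_nonneg z]
  have hslice : ∀ (z : E) (R : ℝ), 0 < R → R * ‖z‖ < 1 →
      DifferentiableOn ℂ (fun l : ℂ => g (l • z)) (Metric.ball 0 R) := fun z R hR hRz =>
    hg.comp (by fun_prop) fun l hl =>
      mem_ball_zero_iff.2 (hmaps z R hR hRz l (mem_ball_zero_iff.1 hl))
  obtain ⟨m, hm⟩ : ∃ m : ℕ, ∀ t : Circle, χ t = (t : ℂ) ^ m := by
    obtain ⟨z, hz, hgz⟩ := hne
    obtain ⟨R, hR1, hRz⟩ := exists_one_lt_mul_norm_lt_one hz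
    have hR0 : 0 < R := by linarith
    refine exists_eq_pow_of_rotation hR0 (hslice z R hR0 hRz) (fun t l hl => ?_)
      ⟨1, by rwa [norm_one], by rwa [one_smul]⟩
    rw [mul_smul, hχ t _ (hmaps z R hR0 hRz l hl)]
  have hhom1 : ∀ (z : E) (l : ℂ), ‖z‖ < 1 → ‖l‖ ≤ 1 → g (l • z) = l ^ m • g z := by
    intro z l hz hl
    obtain ⟨R, hR1, hRz⟩ := exists_one_lt_mul_norm_lt_one hz
    have hR0 : 0 < R := by linarith
    have := eq_pow_smul_of_rotation hR1 (hslice z R hR0 hRz) (k := m) (l := l)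
      (fun t l hl => by rw [mul_smul, hχ t _ (hmaps z R hR0 hRz l hl), hm]) (hl.trans_lt hR1)
    simpa using this
  have hhom : ∀ (z : E) (l : ℂ), ‖z‖ < 1 → ‖l • z‖ < 1 → g (l • z) = l ^ m • g z := by
    intro z l hz hlz
    rcases le_total ‖l‖ 1 with hl | hl
    · exact hhom1 z l hz hl
    · have hl0 : l ≠ 0 := norm_pos_iff.1 (one_pos.trans_le hl)
      have := hhom1 (l • z) l⁻¹ hlz (by rw [norm_inv]; exact inv_le_one_of_one_le₀ hl)
      rw [inv_smul_smul₀ hl0, inv_pow] at this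
      rw [this, smul_inv_smul₀ (pow_ne_zero m hl0)]
  -- Rescale into the ball and undo it by homogeneity. By `hQR` any radius above `‖z‖` gives the
  -- same value, so a fixed radius works near each point and `Q` is holomorphic.
  set Q : E → H := fun z => ((1 + ‖z‖ : ℝ) : ℂ) ^ m • g (((1 + ‖z‖ : ℝ) : ℂ)⁻¹ • z) with hQ
  have hinv : ∀ (z : E) (R : ℝ), ‖z‖ < R → ‖((R : ℝ) : ℂ)⁻¹ • z‖ < 1 := by
    intro z R hR
    have hR0 : 0 < R := (norm_nonneg z).trans_lt hR
    rw [norm_smul, norm_inv, Complex.norm_real, Real.norm_of_nonneg hR0.le, inv_mul_lt_one₀ hR0]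
    exact hR
  have hQR : ∀ (z : E) (R : ℝ), ‖z‖ < R → Q z = (R : ℂ) ^ m • g ((R : ℂ)⁻¹ • z) := by
    intro z R hR
    have hR0 : (R : ℂ) ≠ 0 := by exact_mod_cast ((norm_nonneg z).trans_lt hR).ne'
    have h0 : ((1 + ‖z‖ : ℝ) : ℂ) ≠ 0 := by
      have : 0 < 1 + ‖z‖ := by positivity
      exact_mod_cast this.ne'
    have h1 : ((R : ℂ)⁻¹ * ((1 + ‖z‖ : ℝ) : ℂ)) • (((1 + ‖z‖ : ℝ) : ℂ)⁻¹ • z) = (R : ℂ)⁻¹ • z := by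
      rw [smul_smul, mul_assoc, mul_inv_cancel₀ h0, mul_one]
    have h2 := hhom (((1 + ‖z‖ : ℝ) : ℂ)⁻¹ • z) ((R : ℂ)⁻¹ * ((1 + ‖z‖ : ℝ) : ℂ))
      (hinv z _ (by linarith)) (by rw [h1]; exact hinv z R hR)
    rw [h1] at h2
    rw [h2, smul_smul, ← mul_pow, mul_inv_cancel_left₀ hR0]
  refine ⟨m, hm, Q, ?_, ?_, ?_⟩
  · intro z
    have hz : z ∈ Metric.ball (0 : E) (1 + ‖z‖) := mem_ball_zero_iff.2 (by linarith)
    have hd : DifferentiableOn ℂ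
        (fun w => ((1 + ‖z‖ : ℝ) : ℂ) ^ m • g (((1 + ‖z‖ : ℝ) : ℂ)⁻¹ • w))
        (Metric.ball (0 : E) (1 + ‖z‖)) := by
      refine DifferentiableOn.const_smul (hg.comp (by fun_prop) fun w hw => ?_) _
      exact mem_ball_zero_iff.2 (hinv w _ (mem_ball_zero_iff.1 hw))
    refine ((hd.differentiableAt (Metric.isOpen_ball.mem_nhds hz)).congr_of_eventuallyEq ?_)
    filter_upwards [Metric.isOpen_ball.mem_nhds hz] with w hw
    exact hQR w _ (mem_ball_zero_iff.1 hw)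
  · intro l z
    set R : ℝ := 1 + max ‖z‖ ‖l • z‖
    have h1 : ‖z‖ < R := by linarith [le_max_left ‖z‖ ‖l • z‖]
    have h2 : ‖l • z‖ < R := by linarith [le_max_right ‖z‖ ‖l • z‖]
    have h3 := hinv _ R h2
    rw [hQR z R h1, hQR _ R h2]
    rw [smul_comm] at h3 ⊢
    rw [hhom _ l (hinv z R h1) h3, smul_comm]
  · intro z hz
    rw [hQR z 1 hz]
    simp

/-- Multiplication of the coordinates by the entries of a vector. -/
def dmul {n : ℕ} (t : Fin n → ℂ) (z : Cn n) : Cn n := WithLp.toLp 2 fun i => t i * z i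

theorem dmul_apply {n : ℕ} (t : Fin n → ℂ) (z : Cn n) (i : Fin n) : dmul t z i = t i * z i := rfl

theorem dmul_dmul {n : ℕ} (s t : Fin n → ℂ) (z : Cn n) : dmul s (dmul t z) = dmul (s * t) z := by
  ext i
  simp [dmul_apply, mul_assoc]

theorem dmul_smul {n : ℕ} (t : Fin n → ℂ) (c : ℂ) (z : Cn n) : dmul t (c • z) = c • dmul t z := by
  ext i
  simp [dmul_apply, mul_left_comm]

theorem dmul_const {n : ℕ} (c : ℂ) (z : Cn n) : dmul (fun _ => c) z = c • z := by
  ext i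
  simp [dmul_apply]

theorem norm_dmul {n : ℕ} (t : Fin n → Circle) (z : Cn n) : ‖dmul (fun i => (t i : ℂ)) z‖ = ‖z‖ := by
  rw [EuclideanSpace.norm_eq, EuclideanSpace.norm_eq]
  simp only [dmul_apply, norm_mul, Circle.norm_coe, one_mul]

theorem differentiable_dmul_update {n : ℕ} (i : Fin n) (z : Cn n) :
    Differentiable ℂ fun l : ℂ => dmul (Function.update 1 i l) z := by
  rw [differentiable_euclidean]
  intro j
  simp only [dmul_apply]
  rcases eq_or_ne j i with rfl | h
  · simp only [Function.update_self]
    fun_prop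
  · simp only [Function.update_of_ne h]
    fun_prop

/-- The homogeneous expansion of a map of the ball that intertwines the scalar action of the circle
with isometries. -/
theorem exists_homogeneous_expansion {n N : ℕ} {F : Cn n → Cn N}
    (hF : DifferentiableOn ℂ F (Metric.ball 0 1))
    (hV : ∀ t : Circle, ∃ V : Cn N →ₗᵢ[ℂ] Cn N, ∀ z, ‖z‖ < 1 → F ((t : ℂ) • z) = V (F z)) :
    ∃ (S : Finset ℕ) (Q : ℕ → Cn n → Cn N),
      (∀ m ∈ S, Differentiable ℂ (Q m)) ∧
      (∀ m ∈ S, ∀ (l : ℂ) (z : Cn n), Q m (l • z) = l ^ m • Q m z) ∧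
      (∀ m ∈ S, ∃ z, Q m z ≠ 0) ∧
      (∀ m ∈ S, ∀ k ∈ S, m ≠ k → ∀ z w, inner ℂ (Q m z) (Q k w) = 0) ∧
      ∀ z, ‖z‖ < 1 → F z = ∑ m ∈ S, Q m z := by
  classical
  choose V hV using hV
  let act : Circle → Ball n → Ball n := fun t z =>
    ⟨(t : ℂ) • z, mem_ball_zero_iff.2 (by rw [norm_smul, Circle.norm_coe, one_mul]; exact z.norm_lt)⟩
  obtain ⟨I, P, hI, hsum, horth, heig⟩ := exists_joint_eigen_decomposition
    (fun z : Ball n => F z) act (fun g h z => Subtype.ext (smul_comm (g : ℂ) (h : ℂ) (z : Cn n))) V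
    (fun t z => hV t z z.norm_lt)
  have hext : ∀ χ : Circle → ℂ, χ ∈ I → ∃ m : ℕ, (∀ t : Circle, χ t = (t : ℂ) ^ m) ∧
      ∃ Q : Cn n → Cn N, Differentiable ℂ Q ∧ (∀ (l : ℂ) (z : Cn n), Q (l • z) = l ^ m • Q z) ∧
        ∀ z : Cn n, ‖z‖ < 1 → Q z = P χ (F z) := by
    intro χ hχ
    obtain ⟨x, hx⟩ := hI χ hχ
    exact exists_homogeneous_extension (g := fun z => P χ (F z))
      ((P χ).differentiable.comp_differentiableOn hF)
      (fun t z hz => heig χ t ⟨z, mem_ball_zero_iff.2 hz⟩) ⟨x, x.norm_lt, hx⟩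
  choose! m hm Q hQd hQh hQ using hext
  have hinj : Set.InjOn m I := by
    intro χ hχ χ' hχ' h
    funext t
    rw [hm χ hχ, hm χ' hχ', h]
  -- The degree determines the character, so the components can be reindexed by degree.
  set e : ℕ → Circle → ℂ := Function.invFunOn m I with he
  have heI : ∀ k ∈ I.image m, e k ∈ I ∧ m (e k) = k := by
    intro k hk
    have : ∃ χ ∈ (I : Set (Circle → ℂ)), m χ = k := by simpa using hk
    exact ⟨Function.invFunOn_mem this, Function.invFunOn_eq this⟩
  refine ⟨I.image m, fun k => Q (e k), ?_, ?_, ?_, ?_, ?_⟩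
  · exact fun k hk => hQd _ (heI k hk).1
  · intro k hk l z
    simp only
    rw [hQh _ (heI k hk).1, (heI k hk).2]
  · intro k hk
    obtain ⟨x, hx⟩ := hI _ (heI k hk).1
    exact ⟨x, by simp only; rw [hQ _ (heI k hk).1 x x.norm_lt]; exact hx⟩
  · intro j hj k hk hjk z w
    have hne : e j ≠ e k := fun h => hjk (by rw [← (heI j hj).2, ← (heI k hk).2, h])
    obtain ⟨c, z', hz', rfl⟩ := exists_smul_eq_of_norm_lt_one z
    obtain ⟨d, w', hw', rfl⟩ := exists_smul_eq_of_norm_lt_one w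
    simp only
    rw [hQh _ (heI j hj).1, hQh _ (heI k hk).1, inner_smul_left, inner_smul_right,
      hQ _ (heI j hj).1 _ hz', hQ _ (heI k hk).1 _ hw', horth _ _ hne, mul_zero, mul_zero]
  · intro z hz
    rw [Finset.sum_image hinj]
    rw [hsum ⟨z, mem_ball_zero_iff.2 hz⟩]
    refine Finset.sum_congr rfl fun χ hχ => ?_
    have h1 : e (m χ) = χ :=
      hinj (heI _ (Finset.mem_image_of_mem m hχ)).1 hχ (heI _ (Finset.mem_image_of_mem m hχ)).2
    simp only
    rw [h1, hQ χ hχ z hz]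

/-- The monomial expansion of a map of the ball that intertwines the action of the diagonal torus
with isometries. -/
theorem exists_monomial_expansion {n N : ℕ} {F : Cn n → Cn N}
    (hF : DifferentiableOn ℂ F (Metric.ball 0 1))
    (hV : ∀ t : Fin n → Circle, ∃ V : Cn N →ₗᵢ[ℂ] Cn N,
      ∀ z, ‖z‖ < 1 → F (dmul (fun i => (t i : ℂ)) z) = V (F z)) :
    ∃ (I : Finset ((Fin n → Circle) → ℂ)) (α : ((Fin n → Circle) → ℂ) → Fin n → ℕ)
      (c : ((Fin n → Circle) → ℂ) → Cn N),
      (∀ χ ∈ I, c χ ≠ 0) ∧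
      (∀ χ ∈ I, ∀ χ' ∈ I, χ ≠ χ' → inner ℂ (c χ) (c χ') = 0) ∧
      ∀ z, ‖z‖ < 1 → F z = ∑ χ ∈ I, (∏ i, z i ^ α χ i) • c χ := by
  classical
  choose V hV using hV
  let act : (Fin n → Circle) → Ball n → Ball n := fun t z =>
    ⟨dmul (fun i => (t i : ℂ)) z, mem_ball_zero_iff.2 (by rw [norm_dmul]; exact z.norm_lt)⟩
  obtain ⟨I, P, hI, hsum, horth, heig⟩ := exists_joint_eigen_decomposition
    (fun z : Ball n => F z) act
    (fun g h z => Subtype.ext (by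
      change dmul _ (dmul _ _) = dmul _ (dmul _ _)
      rw [dmul_dmul, dmul_dmul, mul_comm]))
    V (fun t z => hV t z z.norm_lt)
  have key : ∀ χ : (Fin n → Circle) → ℂ, χ ∈ I → ∃ (α : Fin n → ℕ) (c : Cn N), c ≠ 0 ∧
      (∃ (a : ℂ) (x : Ball n), c = a • P χ (F x)) ∧
      ∀ z : Cn n, ‖z‖ < 1 → P χ (F z) = (∏ i, z i ^ α i) • c := by
    intro χ hχ
    obtain ⟨x, hx⟩ := hI χ hχ
    -- The scalar circle inside the torus already yields an entire extension, on which single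
    -- coordinates may be varied freely.
    obtain ⟨m, hm, Q, hQd, hQh, hQ⟩ := exists_homogeneous_extension (g := fun z => P χ (F z))
      (χ := fun t => χ fun _ => t)
      ((P χ).differentiable.comp_differentiableOn hF)
      (fun t z hz => by
        rw [← heig χ (fun _ => t) ⟨z, mem_ball_zero_iff.2 hz⟩, ← dmul_const])
      ⟨x, x.norm_lt, hx⟩
    have hQt : ∀ (t : Fin n → Circle) (z : Cn n), Q (dmul (fun i => (t i : ℂ)) z) = χ t • Q z := by
      intro t z
      obtain ⟨c, z', hz', rfl⟩ := exists_smul_eq_of_norm_lt_one z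
      rw [dmul_smul, hQh, hQh, hQ z' hz', hQ _ (by rwa [norm_dmul]), smul_comm (χ t)]
      congr 1
      exact heig χ t ⟨z', mem_ball_zero_iff.2 hz'⟩
    have hupd : ∀ (i : Fin n) (t : Circle) (l : ℂ) (z : Cn n),
        Q (dmul (Function.update 1 i (t * l)) z)
          = χ (Function.update 1 i t) • Q (dmul (Function.update 1 i l) z) := by
      intro i t l z
      rw [← hQt, dmul_dmul]
      congr 2
      funext j
      rcases eq_or_ne j i with rfl | h
      · simp
      · simp [Function.update_of_ne h]
    have hone : ∀ (i : Fin n) (z : Cn n), dmul (Function.update 1 i 1) z = z := by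
      intro i z
      ext j
      rw [dmul_apply]
      rcases eq_or_ne j i with rfl | h
      · simp
      · simp [Function.update_of_ne h]
    have hslice : ∀ (i : Fin n) (z : Cn n),
        Differentiable ℂ fun l : ℂ => Q (dmul (Function.update 1 i l) z) := fun i z =>
      hQd.comp (differentiable_dmul_update i z)
    -- Rotating only the coordinate `i` produces the exponent `α i`.
    have hk : ∀ i : Fin n, ∃ k : ℕ, ∀ t : Circle, χ (Function.update 1 i t) = (t : ℂ) ^ k := by
      intro i
      refine exists_eq_pow_of_rotation (R := 2) two_pos (hslice i x).differentiableOn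
        (fun t l _ => hupd i t l x) ⟨1, by norm_num, ?_⟩
      rw [hone, hQ x x.norm_lt]
      exact hx
    choose α hα using hk
    have hline : ∀ (i : Fin n) (l : ℂ) (z : Cn n),
        Q (dmul (Function.update 1 i l) z) = l ^ α i • Q z := by
      intro i l z
      have := eq_pow_smul_of_rotation (R := 2 + ‖l‖) (by linarith [norm_nonneg l])
        (hslice i z).differentiableOn (k := α i)
        (fun t l _ => by rw [hupd, hα]) (l := l) (by linarith)
      rwa [hone] at this
    -- Scaling the coordinates one at a time leads from `(1, …, 1)` to any `z`, whence `Q z = z^α Q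
    -- (1, …, 1)`.
    have hfin : ∀ (A : Finset (Fin n)) (s : Fin n → ℂ) (z : Cn n),
        Q (dmul (fun i => if i ∈ A then s i else 1) z) = (∏ i ∈ A, s i ^ α i) • Q z := by
      intro A s z
      induction A using Finset.induction_on with
      | empty =>
        simp only [Finset.notMem_empty, if_false, Finset.prod_empty, one_smul]
        rw [dmul_const, one_smul]
      | insert i A hi ih =>
        rw [Finset.prod_insert hi, mul_smul, ← ih, ← hline, dmul_dmul]
        congr 2
        funext j
        rcases eq_or_ne j i with rfl | h
        · simp [hi]
        · simp [h]
    have hall : ∀ z : Cn n, Q z = (∏ i, z i ^ α i) • Q (WithLp.toLp 2 1) := by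
      intro z
      rw [← hfin Finset.univ (fun i => z i)]
      congr 1
      ext i
      simp [dmul_apply]
    have hc0 : Q (WithLp.toLp 2 1) ≠ 0 := by
      intro h
      apply hx
      have := hQ x x.norm_lt
      rw [hall, h, smul_zero] at this
      exact this.symm
    refine ⟨α, Q (WithLp.toLp 2 1), hc0, ?_, ?_⟩
    -- The point `(1, …, 1)` need not lie in the ball; as a multiple of a value of the projection,
    -- the coefficient inherits orthogonality.
    · obtain ⟨c, z', hz', h⟩ := exists_smul_eq_of_norm_lt_one (WithLp.toLp 2 1 : Cn n)
      refine ⟨c ^ m, ⟨z', mem_ball_zero_iff.2 hz'⟩, ?_⟩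
      rw [h, hQh, hQ z' hz']
    · intro z hz
      rw [← hall, hQ z hz]
  choose! α c hc hcP hP using key
  refine ⟨I, α, c, hc, ?_, ?_⟩
  · intro χ hχ χ' hχ' h
    obtain ⟨a, x, hx⟩ := hcP χ hχ
    obtain ⟨b, y, hy⟩ := hcP χ' hχ'
    rw [hx, hy, inner_smul_left, inner_smul_right, horth χ χ' h, mul_zero, mul_zero]
  · intro z hz
    rw [hsum ⟨z, mem_ball_zero_iff.2 hz⟩]
    exact Finset.sum_congr rfl fun χ hχ => hP χ hχ z hz

/-! ### Normalisation at the origin -/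

theorem mem_sourceGroup {n N : ℕ} {f : Ball n → Ball N} {γ : Aut n} :
    γ ∈ sourceGroup f ↔ ∃ ψ : Aut N, ∀ z, f (γ.toFun z) = ψ.toFun (f z) := by
  constructor
  · rintro ⟨⟨γ', ψ⟩, h, rfl⟩
    exact ⟨ψ, congrFun h⟩
  · rintro ⟨ψ, h⟩
    exact ⟨(γ, ψ), funext h, rfl⟩

theorem mem_sourceGroup_comp {n N : ℕ} {f : Ball n → Ball N} (φ : Aut N) (β γ : Aut n) :
    γ ∈ sourceGroup (φ.toFun ∘ f ∘ β.toFun) ↔ β * γ * β⁻¹ ∈ sourceGroup f := by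
  rw [mem_sourceGroup, mem_sourceGroup]
  constructor
  · rintro ⟨ψ, h⟩
    refine ⟨φ⁻¹ * ψ * φ, fun z => ?_⟩
    have h1 := h (β⁻¹.toFun z)
    simp only [Function.comp_apply, Aut.toFun_inv_toFun] at h1
    simp only [Aut.mul_toFun]
    rw [← h1, Aut.inv_toFun_toFun]
  · rintro ⟨ψ, h⟩
    refine ⟨φ * ψ * φ⁻¹, fun z => ?_⟩
    have h1 := h (β.toFun z)
    simp only [Aut.mul_toFun, Aut.inv_toFun_toFun] at h1
    simp only [Function.comp_apply, Aut.mul_toFun, Aut.inv_toFun_toFun]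
    rw [h1]

/-- The partner fixes the origin, as `ψ 0 = ψ (f 0) = f (γ 0) = 0`, so Cartan's theorem applies to
it. -/
theorem exists_isometry_of_mem_sourceGroup {n N : ℕ} {f : Ball n → Ball N}
    (h0 : f (Ball.origin n) = Ball.origin N) {γ : Aut n} (hγ : γ ∈ sourceGroup f)
    (hγ0 : γ.toFun (Ball.origin n) = Ball.origin n) :
    ∃ L : Cn N ≃ₗᵢ[ℂ] Cn N, ∀ z, (f (γ.toFun z) : Cn N) = L (f z) := by
  obtain ⟨ψ, hψ⟩ := mem_sourceGroup.1 hγ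
  obtain ⟨L, rfl⟩ := ψ.exists_isometry (by rw [← h0, ← hψ, hγ0])
  exact ⟨L, fun z => by rw [hψ]; rfl⟩

theorem sphericallyEquivalent_comp {n N : ℕ} (f : Ball n → Ball N) (φ : Aut N) (β : Aut n) :
    SphericallyEquivalent f (φ.toFun ∘ f ∘ β.toFun) :=
  ⟨β, φ⁻¹, funext fun _ => φ.inv_toFun_toFun _⟩

theorem SphericallyEquivalent.post_comp {n N : ℕ} {f g : Ball n → Ball N}
    (h : SphericallyEquivalent f g) (φ : Aut N) : SphericallyEquivalent f (φ.toFun ∘ g) := by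
  obtain ⟨γ, ψ, h⟩ := h
  refine ⟨γ, ψ * φ⁻¹, ?_⟩
  rw [← h]
  funext z
  simp only [Function.comp_apply, Aut.mul_toFun, Aut.inv_toFun_toFun]

theorem isometryToAut_origin {n : ℕ} (L : Cn n ≃ₗᵢ[ℂ] Cn n) :
    (isometryToAut n L).toFun (Ball.origin n) = Ball.origin n :=
  Subtype.ext (map_zero L)

/-- Every map of the ball can be composed with automorphisms so that it fixes the origin. -/
theorem IsHolomorphic.exists_normalization {n N : ℕ} {f : Ball n → Ball N} (hf : IsHolomorphic f)
    (β : Aut n) : ∃ φ : Aut N, IsHolomorphic (φ.toFun ∘ f ∘ β.toFun) ∧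
      (φ.toFun ∘ f ∘ β.toFun) (Ball.origin n) = Ball.origin N ∧
      ∃ b : Ball N, φ = mobius b :=
  ⟨mobius (f (β.toFun (Ball.origin n))), (Aut.isHolomorphic _).comp (hf.comp β.isHolomorphic),
    mobius_self _, _, rfl⟩

theorem unitaryToAut_origin {n : ℕ} (U : Matrix.unitaryGroup (Fin n) ℂ) :
    (unitaryToAut n U).toFun (Ball.origin n) = Ball.origin n := by
  obtain ⟨L, hL⟩ := exists_isometryToAut_eq U
  rw [hL, isometryToAut_origin]

/-! ### Maps that are equivariant under a maximal torus -/

/-- The diagonal unitary matrix with the given entries. -/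
def diagonalUnitary {n : ℕ} (t : Fin n → Circle) : Matrix.unitaryGroup (Fin n) ℂ :=
  ⟨Matrix.diagonal fun i => (t i : ℂ), by
    have h : ∀ i, (t i : ℂ) * star (t i : ℂ) = 1 := fun i => by
      rw [Complex.star_def, Complex.mul_conj, Circle.normSq_coe, Complex.ofReal_one]
    rw [Matrix.mem_unitaryGroup_iff, Matrix.star_eq_conjTranspose, Matrix.diagonal_conjTranspose,
      Matrix.diagonal_mul_diagonal, ← Matrix.diagonal_one]
    exact congrArg Matrix.diagonal (funext h)⟩

theorem diagonalUnitary_apply {n : ℕ} (t : Fin n → Circle) (z : Ball n) :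
    ((unitaryToAut n (diagonalUnitary t)).toFun z : Cn n) = dmul (fun i => (t i : ℂ)) z := by
  rw [unitaryToAut_apply]
  ext i
  simp [diagonalUnitary, dmul_apply, Matrix.mulVec_diagonal]

theorem diagonalUnitary_mem {n : ℕ} (t : Fin n → Circle) : diagonalUnitary t ∈ diagonalTorus n :=
  Matrix.isDiag_diagonal _

/-- An orthonormal basis of `ℂᴺ` each of whose members is orthogonal to all but at most one of a
given family of pairwise orthogonal nonzero vectors. -/
theorem exists_orthonormalBasis_adapted {N : ℕ} {ι : Type*} (I : Finset ι) (c : ι → Cn N)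
    (hc0 : ∀ i ∈ I, c i ≠ 0) (hc : ∀ i ∈ I, ∀ j ∈ I, i ≠ j → inner ℂ (c i) (c j) = 0) :
    ∃ b : OrthonormalBasis (Fin N) ℂ (Cn N), ∀ j, ∀ i ∈ I, ∀ i' ∈ I,
      inner ℂ (b j) (c i) ≠ 0 → inner ℂ (b j) (c i') ≠ 0 → i = i' := by
  set v : I → Cn N := fun i => ((‖c i‖ : ℂ)⁻¹) • c i with hv
  have hvo : Orthonormal ℂ v := by
    refine ⟨fun i => ?_, fun i j hij => ?_⟩
    · have := norm_ne_zero_iff.2 (hc0 i i.2)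
      simp only [hv, norm_smul, norm_inv, Complex.norm_real, norm_norm]
      exact inv_mul_cancel₀ this
    · simp only [hv]
      rw [inner_smul_left, inner_smul_right, hc i i.2 j j.2 (fun h => hij (Subtype.ext h)),
        mul_zero, mul_zero]
  obtain ⟨u, b, hu, hb⟩ := hvo.toSubtypeRange.exists_orthonormalBasis_extension
  have hcard : Fintype.card u = Fintype.card (Fin N) := by
    rw [← Module.finrank_eq_card_basis b.toBasis, finrank_euclideanSpace]
  let e : u ≃ Fin N := Fintype.equivOfCardEq hcard
  -- A basis vector not orthogonal to `c i` must be the normalised `c i` itself.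
  have hmem : ∀ k : u, ∀ i (hi : i ∈ I), inner ℂ (b k) (c i) ≠ 0 → (k : Cn N) = v ⟨i, hi⟩ := by
    intro k i hi h
    by_contra hne
    apply h
    have hvu : v ⟨i, hi⟩ ∈ u := hu (Set.mem_range_self _)
    have h1 : inner ℂ (b k) (b ⟨v ⟨i, hi⟩, hvu⟩) = 0 :=
      b.orthonormal.2 fun h => hne (congrArg Subtype.val h)
    rw [hb] at h1 ⊢
    simp only [hv, inner_smul_right] at h1
    refine (mul_eq_zero.1 h1).resolve_left (inv_ne_zero ?_)
    exact_mod_cast norm_ne_zero_iff.2 (hc0 i hi)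
  refine ⟨b.reindex e, fun j i hi i' hi' h h' => ?_⟩
  rw [OrthonormalBasis.reindex_apply] at h h'
  have h1 := (hmem _ i hi h).symm.trans (hmem _ i' hi' h')
  exact congrArg Subtype.val (hvo.linearIndependent.injective h1)

/-- In a basis adapted to the orthogonal coefficient vectors, each coordinate meets at most one term
of the monomial expansion. -/
theorem exists_monomialMap {n N : ℕ} {f : Ball n → Ball N} (hf : IsHolomorphic f) (β : Aut n)
    (hβ : ((diagonalTorus n).map (unitaryToAut n)).map (MulAut.conj β).toMonoidHom
      ≤ sourceGroup f) :
    ∃ g : Ball n → Ball N, SphericallyEquivalent f g ∧ IsMonomialMap g := by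
  obtain ⟨φ, hf0, h0, -⟩ := hf.exists_normalization β
  set f₀ := φ.toFun ∘ f ∘ β.toFun with hf₀
  obtain ⟨F, hF, hFf⟩ := hf0
  have hV : ∀ t : Fin n → Circle, ∃ V : Cn N →ₗᵢ[ℂ] Cn N,
      ∀ z, ‖z‖ < 1 → F (dmul (fun i => (t i : ℂ)) z) = V (F z) := by
    intro t
    have hmem : unitaryToAut n (diagonalUnitary t) ∈ sourceGroup f₀ := by
      rw [hf₀, mem_sourceGroup_comp]
      exact hβ ⟨_, ⟨_, diagonalUnitary_mem t, rfl⟩, rfl⟩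
    obtain ⟨L, hL⟩ := exists_isometry_of_mem_sourceGroup h0 hmem (unitaryToAut_origin _)
    refine ⟨L.toLinearIsometry, fun z hz => ?_⟩
    have := hL ⟨z, mem_ball_zero_iff.2 hz⟩
    rw [← hFf, ← hFf, diagonalUnitary_apply] at this
    exact this
  obtain ⟨I, α, c, hc0, hc, hsum⟩ := exists_monomial_expansion hF hV
  obtain ⟨b, hb⟩ := exists_orthonormalBasis_adapted I c hc0 hc
  refine ⟨(isometryToAut N b.repr).toFun ∘ f₀,
    (sphericallyEquivalent_comp f φ β).post_comp _, fun j => ?_⟩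
  have hcoord : ∀ z : Ball n, (((isometryToAut N b.repr).toFun ∘ f₀) z : Cn N) j
      = ∑ χ ∈ I, (∏ i, (z : Cn n) i ^ α χ i) * inner ℂ (b j) (c χ) := by
    intro z
    rw [Function.comp_apply, isometryToAut_apply, b.repr_apply_apply, ← hFf, hsum z z.norm_lt,
      inner_sum]
    exact Finset.sum_congr rfl fun χ _ => inner_smul_right _ _ _
  by_cases h : ∃ χ ∈ I, inner ℂ (b j) (c χ) ≠ 0
  · obtain ⟨χ, hχ, hne⟩ := h
    refine ⟨inner ℂ (b j) (c χ), α χ, fun z => ?_⟩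
    rw [hcoord, Finset.sum_eq_single_of_mem χ hχ, mul_comm]
    intro χ' hχ' hχχ'
    by_contra h
    exact hχχ' (hb j χ' hχ' χ hχ (right_ne_zero_of_mul h) hne)
  · push Not at h
    refine ⟨0, 0, fun z => ?_⟩
    rw [hcoord, zero_mul]
    exact Finset.sum_eq_zero fun χ hχ => by rw [h χ hχ, mul_zero]

/-! ### Maps whose source group contains the centre of the unitary group -/

theorem diagonalUnitary_const_mem_center {n : ℕ} (t : Circle) :
    diagonalUnitary (fun _ : Fin n => t) ∈ Subgroup.center (Matrix.unitaryGroup (Fin n) ℂ) := by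
  rw [Subgroup.mem_center_iff]
  intro U
  refine Subtype.ext ?_
  change U.1 * Matrix.diagonal (fun _ => (t : ℂ)) = Matrix.diagonal (fun _ => (t : ℂ)) * U.1
  ext i j
  rw [Matrix.mul_diagonal, Matrix.diagonal_mul, mul_comm]

theorem exists_homogeneous_expansion_of_center {n N : ℕ} {f : Ball n → Ball N}
    (hf : IsHolomorphic f) (h0 : f (Ball.origin n) = Ball.origin N)
    (hc : (Subgroup.center (Matrix.unitaryGroup (Fin n) ℂ)).map (unitaryToAut n)
      ≤ sourceGroup f) :
    ∃ (S : Finset ℕ) (Q : ℕ → Cn n → Cn N),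
      (∀ m ∈ S, 1 ≤ m) ∧
      (∀ m ∈ S, Differentiable ℂ (Q m)) ∧
      (∀ m ∈ S, ∀ (l : ℂ) (z : Cn n), Q m (l • z) = l ^ m • Q m z) ∧
      (∀ m ∈ S, ∃ z, Q m z ≠ 0) ∧
      (∀ m ∈ S, ∀ k ∈ S, m ≠ k → ∀ z w, inner ℂ (Q m z) (Q k w) = 0) ∧
      ∀ z : Ball n, (f z : Cn N) = ∑ m ∈ S, Q m z := by
  obtain ⟨F, hF, hFf⟩ := hf
  have hV : ∀ t : Circle, ∃ V : Cn N →ₗᵢ[ℂ] Cn N, ∀ z, ‖z‖ < 1 → F ((t : ℂ) • z) = V (F z) := by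
    intro t
    have hmem : unitaryToAut n (diagonalUnitary fun _ => t) ∈ sourceGroup f :=
      hc ⟨_, diagonalUnitary_const_mem_center t, rfl⟩
    obtain ⟨L, hL⟩ := exists_isometry_of_mem_sourceGroup h0 hmem (unitaryToAut_origin _)
    refine ⟨L.toLinearIsometry, fun z hz => ?_⟩
    have := hL ⟨z, mem_ball_zero_iff.2 hz⟩
    rw [← hFf, ← hFf, diagonalUnitary_apply, dmul_const] at this
    exact this
  obtain ⟨S, Q, hd, hh, hne, ho, hsum⟩ := exists_homogeneous_expansion hF hV
  refine ⟨S, Q, ?_, hd, hh, hne, ho, fun z => ?_⟩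
  -- A component of degree zero is constant; pairing it with `F 0 = 0` leaves its squared norm by
  -- orthogonality, so it would vanish.
  · intro m hm
    by_contra hlt
    obtain rfl : m = 0 := by omega
    have hconst : ∀ z, Q 0 z = Q 0 0 := fun z => by
      have := hh 0 hm 0 z
      rw [zero_smul, pow_zero, one_smul] at this
      exact this.symm
    obtain ⟨z, hz⟩ := hne 0 hm
    rw [hconst] at hz
    have h1 : F 0 = 0 := by
      have := hFf (Ball.origin n)
      rw [h0] at this
      exact this
    rw [hsum 0 (by simp)] at h1
    have h2 : inner ℂ (Q 0 0) (∑ m ∈ S, Q m 0) = inner ℂ (Q 0 0) (Q 0 0) := by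
      rw [inner_sum]
      exact Finset.sum_eq_single_of_mem 0 hm fun k hk hk0 => ho 0 hm k hk hk0.symm 0 0
    rw [h1, inner_zero_right] at h2
    exact hz (inner_self_eq_zero.1 h2.symm)
  · rw [← hFf, hsum z z.norm_lt]

/-! ### Maps that are equivariant under the unitary group -/

theorem eq_zero_of_sum_pow_mul_eq_zero {S : Finset ℕ} {a : ℕ → ℂ}
    (h : ∀ l : ℂ, ‖l‖ < 1 → ∑ m ∈ S, l ^ m * a m = 0) : ∀ m ∈ S, a m = 0 := by
  set p : Polynomial ℂ := ∑ m ∈ S, Polynomial.monomial m (a m) with hp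
  have h0 : p = 0 := by
    refine Polynomial.eq_zero_of_infinite_isRoot p (Set.Infinite.mono (s := Metric.ball 0 1) ?_ ?_)
    · intro l hl
      change Polynomial.eval l p = 0
      rw [hp, Polynomial.eval_finsetSum, ← h l (mem_ball_zero_iff.1 hl)]
      exact Finset.sum_congr rfl fun m _ => by rw [Polynomial.eval_monomial, mul_comm]
    · exact infinite_of_mem_nhds (0 : ℂ) (Metric.ball_mem_nhds _ one_pos)
  intro m hm
  have h1 : p.coeff m = a m := by
    rw [hp, Polynomial.finsetSum_coeff, Finset.sum_eq_single_of_mem m hm]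
    · exact Polynomial.coeff_monomial_same m _
    · exact fun k _ hk => Polynomial.coeff_monomial_of_ne _ hk.symm
  rw [← h1, h0, Polynomial.coeff_zero]

/-- The rotation by `t` in the orthogonal complement of a unit vector `w`. -/
theorem exists_rotation {n : ℕ} {w : Cn n} (hw : ‖w‖ = 1) (t : Circle) :
    ∃ L : Cn n ≃ₗᵢ[ℂ] Cn n, ∀ x, L x = (t : ℂ) • x + ((1 - (t : ℂ)) * inner ℂ w x) • w := by
  let A : Cn n →ₗ[ℂ] Cn n := (t : ℂ) • LinearMap.id +
    (1 - (t : ℂ)) • ((innerSL ℂ w).toLinearMap.smulRight w)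
  have hA : ∀ x, A x = (t : ℂ) • x + ((1 - (t : ℂ)) * inner ℂ w x) • w := fun x => by
    simp [A, smul_smul]
  have hnorm : ∀ x, ‖A x‖ = ‖x‖ := by
    intro x
    rw [← sq_eq_sq₀ (norm_nonneg _) (norm_nonneg _), hA, @norm_add_sq ℂ, norm_smul, norm_smul, hw,
      Circle.norm_coe, inner_smul_left, inner_smul_right, ← inner_conj_symm x w, one_mul, mul_one]
    have ht : (t : ℂ).re * (t : ℂ).re + (t : ℂ).im * (t : ℂ).im = 1 := by
      have := Circle.normSq_coe t
      rwa [Complex.normSq_apply] at this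
    rw [Complex.sq_norm ((1 - (t : ℂ)) * inner ℂ w x), Complex.normSq_mul, Complex.normSq_apply,
      Complex.normSq_apply]
    generalize inner ℂ w x = c at *
    generalize (t : ℂ) = s at *
    simp
    linear_combination (-(c.re * c.re + c.im * c.im)) * ht
  refine ⟨LinearIsometry.toLinearIsometryEquiv ⟨A, hnorm⟩ rfl, fun x => ?_⟩
  exact hA x

/-- A homogeneous map whose Gram kernel is unitarily invariant has as Gram kernel a multiple of the
power of the inner product. -/
theorem exists_inner_eq_pow {n N m : ℕ} {Q : Cn n → Cn N} (hm : 1 ≤ m) (hd : Differentiable ℂ Q)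
    (hh : ∀ (l : ℂ) (z : Cn n), Q (l • z) = l ^ m • Q z) (hne : ∃ z, Q z ≠ 0)
    (hU : ∀ (L : Cn n ≃ₗᵢ[ℂ] Cn n) (z w : Cn n), inner ℂ (Q (L z)) (Q (L w)) = inner ℂ (Q z) (Q w)) :
    ∃ C : ℝ, 0 < C ∧ ∀ z w, inner ℂ (Q z) (Q w) = (C : ℂ) * inner ℂ z w ^ m := by
  have hQ0 : Q 0 = 0 := by
    have := hh 0 0
    rwa [zero_pow (by omega), zero_smul, zero_smul] at this
  -- Split `z` into its part along `w` and `q ⟂ w`. Rotations that fix `w` make `h` rotation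
  -- invariant, hence constant, and `h 1 = h 0` removes `q`.
  have hunit : ∀ w : Cn n, ‖w‖ = 1 → ∀ z, inner ℂ (Q w) (Q z)
      = inner ℂ w z ^ m * inner ℂ (Q w) (Q w) := by
    intro w hw z
    set q : Cn n := z - inner ℂ w z • w with hq
    have hww : inner ℂ w w = (1 : ℂ) := by rw [inner_self_eq_norm_sq_to_K, hw]; simp
    have hwq : inner ℂ w q = (0 : ℂ) := by
      rw [hq, inner_sub_right, inner_smul_right, hww, mul_one, sub_self]
    set h : ℂ → ℂ := fun l => inner ℂ (Q w) (Q (inner ℂ w z • w + l • q)) with hh'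
    have hdiff : Differentiable ℂ h := by
      have h1 : Differentiable ℂ fun l : ℂ => Q (inner ℂ w z • w + l • q) :=
        hd.comp (by fun_prop)
      exact (innerSL ℂ (Q w)).differentiable.comp h1
    have hinv : ∀ (t : Circle) (l : ℂ), h (t * l) = h l := by
      intro t l
      obtain ⟨L, hL⟩ := exists_rotation hw t
      have hLw : L w = w := by
        rw [hL, hww, mul_one, ← add_smul, add_sub_cancel, one_smul]
      have hLq : L q = (t : ℂ) • q := by
        rw [hL, hwq, mul_zero, zero_smul, add_zero]
      have hLl : L (inner ℂ w z • w + l • q) = inner ℂ w z • w + ((t : ℂ) * l) • q := by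
        rw [map_add, map_smul, map_smul, hLw, hLq, smul_smul, mul_comm]
      simp only [hh']
      rw [← hLl, ← hU L w (inner ℂ w z • w + l • q), hLw]
    have h01 := eq_pow_smul_of_rotation (R := 2) one_lt_two hdiff.differentiableOn (k := 0)
      (fun t l _ => by rw [hinv, pow_zero, one_smul]) (l := 0) (by simp)
    simp only [hh', pow_zero, one_smul, zero_smul, add_zero, hh, inner_smul_right] at h01
    rw [h01, hq, add_sub_cancel]
  have hgen : ∀ w z, inner ℂ (Q w) (Q z) * (‖w‖ : ℂ) ^ (2 * m)
      = inner ℂ w z ^ m * inner ℂ (Q w) (Q w) := by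
    intro w z
    rcases eq_or_ne w 0 with rfl | hw0
    · rw [hQ0, inner_zero_left, inner_zero_left, inner_zero_left, zero_mul, mul_zero]
    have hr : (‖w‖ : ℂ) ≠ 0 := by exact_mod_cast norm_ne_zero_iff.2 hw0
    obtain ⟨u, hu, hwu⟩ : ∃ u : Cn n, ‖u‖ = 1 ∧ w = (‖w‖ : ℂ) • u := by
      refine ⟨(‖w‖ : ℂ)⁻¹ • w, ?_, (smul_inv_smul₀ hr w).symm⟩
      rw [norm_smul, norm_inv, Complex.norm_real, norm_norm,
        inv_mul_cancel₀ (norm_ne_zero_iff.2 hw0)]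
    generalize ‖w‖ = r at *
    subst hwu
    rw [hh, inner_smul_left, inner_smul_left, inner_smul_left, inner_smul_right, hunit u hu z]
    simp only [map_pow, Complex.conj_ofReal]
    ring
  obtain ⟨w₀, hw₀⟩ := hne
  have hw₀0 : w₀ ≠ 0 := by
    rintro rfl
    exact hw₀ hQ0
  -- Comparing `hgen` with its conjugate after swapping `w` and `z` shows that the ratio agrees on
  -- non-orthogonal vectors.
  have hrep : ∀ w z, inner ℂ w z ≠ (0 : ℂ) → w ≠ 0 → z ≠ 0 →
      ‖Q w‖ ^ 2 / ‖w‖ ^ (2 * m) = ‖Q z‖ ^ 2 / ‖z‖ ^ (2 * m) := by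
    intro w z hwz hw hz
    have h1 := hgen w z
    have h2 := congrArg (starRingEnd ℂ) (hgen z w)
    simp only [map_mul, map_pow, inner_conj_symm, Complex.conj_ofReal] at h2
    have h3 : inner ℂ (Q w) (Q w) * (‖z‖ : ℂ) ^ (2 * m)
        = inner ℂ (Q z) (Q z) * (‖w‖ : ℂ) ^ (2 * m) := by
      refine mul_left_cancel₀ (pow_ne_zero m hwz) ?_
      rw [← mul_assoc, ← mul_assoc, ← h1, ← h2]
      ring
    rw [inner_self_eq_norm_sq_to_K, inner_self_eq_norm_sq_to_K] at h3
    have h4 : ‖Q w‖ ^ 2 * ‖z‖ ^ (2 * m) = ‖Q z‖ ^ 2 * ‖w‖ ^ (2 * m) := by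
      refine Complex.ofReal_injective ?_
      push_cast
      exact h3
    have hw' := norm_pos_iff.2 hw
    have hz' := norm_pos_iff.2 hz
    rw [div_eq_div_iff (by positivity) (by positivity), h4]
  set C : ℝ := ‖Q w₀‖ ^ 2 / ‖w₀‖ ^ (2 * m) with hC
  have hCz : ∀ z, z ≠ 0 → ‖Q z‖ ^ 2 / ‖z‖ ^ (2 * m) = C := by
    intro z hz
    by_cases h : inner ℂ z w₀ = (0 : ℂ)
    · have h' : inner ℂ w₀ z = (0 : ℂ) := inner_eq_zero_symm.1 h
      have h1 : inner ℂ z (z + w₀) ≠ (0 : ℂ) := by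
        rw [inner_add_right, h, add_zero]
        exact fun h => hz (inner_self_eq_zero.1 h)
      have h2 : inner ℂ w₀ (z + w₀) ≠ (0 : ℂ) := by
        rw [inner_add_right, h', zero_add]
        exact fun h => hw₀0 (inner_self_eq_zero.1 h)
      have h3 : z + w₀ ≠ 0 := fun h3 => h1 (by rw [h3, inner_zero_right])
      rw [hC, hrep z _ h1 hz h3, hrep w₀ _ h2 hw₀0 h3]
    · exact hrep z w₀ h hz hw₀0
  have h1 := norm_pos_iff.2 hw₀
  have h2 := norm_pos_iff.2 hw₀0
  refine ⟨C, by positivity, fun z w => ?_⟩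
  rcases eq_or_ne z 0 with rfl | hz
  · rw [hQ0, inner_zero_left, inner_zero_left, zero_pow (by omega), mul_zero]
  have hr : (‖z‖ : ℂ) ^ (2 * m) ≠ 0 :=
    pow_ne_zero _ (by exact_mod_cast norm_ne_zero_iff.2 hz)
  have h3 : inner ℂ (Q z) (Q z) = (C : ℂ) * (‖z‖ : ℂ) ^ (2 * m) := by
    have h4 := hCz z hz
    rw [div_eq_iff (pow_ne_zero _ (norm_ne_zero_iff.2 hz))] at h4
    rw [inner_self_eq_norm_sq_to_K]
    have : ((‖Q z‖ ^ 2 : ℝ) : ℂ) = ((C * ‖z‖ ^ (2 * m) : ℝ) : ℂ) := by rw [h4]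
    push_cast at this
    exact this
  refine mul_right_cancel₀ hr ?_
  rw [hgen, h3]
  ring

theorem inner_tensorPow {n m : ℕ} (z w : Cn n) :
    inner ℂ (tensorPow m z) (tensorPow m w) = inner ℂ z w ^ m := by
  simp only [tensorPow, PiLp.inner_apply, Fintype.sum_pow]
  refine Finset.sum_congr rfl fun s _ => ?_
  simp [Finset.prod_mul_distrib]

/-- Two families of vectors with the same Gram matrix are related by a linear isometry. -/
theorem exists_linearIsometry_of_gram {ι H K : Type*} [NormedAddCommGroup H]
    [InnerProductSpace ℂ H] [NormedAddCommGroup K] [InnerProductSpace ℂ K] (x : ι → H) (y : ι → K)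
    (hxy : ∀ i j, inner ℂ (x i) (x j) = inner ℂ (y i) (y j)) :
    ∃ V : Submodule.span ℂ (Set.range x) →ₗᵢ[ℂ] K,
      (∀ i, V ⟨x i, Submodule.subset_span (Set.mem_range_self i)⟩ = y i) ∧
      ∀ u, V u ∈ Submodule.span ℂ (Set.range y) := by
  set A := Finsupp.linearCombination ℂ x with hA
  set B := Finsupp.linearCombination ℂ y with hB
  have hinner : ∀ u, inner ℂ (A u) (A u) = inner ℂ (B u) (B u) := by
    intro u
    simp only [hA, hB, Finsupp.linearCombination_apply, Finsupp.sum, sum_inner, inner_sum,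
      inner_smul_left, inner_smul_right, hxy]
  have hnorm : ∀ u, ‖A u‖ = ‖B u‖ := by
    intro u
    rw [@norm_eq_sqrt_re_inner ℂ, @norm_eq_sqrt_re_inner ℂ, hinner]
  have hr : ∀ v : Submodule.span ℂ (Set.range x), (v : H) ∈ LinearMap.range A := fun v => by
    rw [hA, Finsupp.range_linearCombination]
    exact v.2
  let A' : (ι →₀ ℂ) →ₗ[ℂ] Submodule.span ℂ (Set.range x) := A.codRestrict _ fun u => by
    rw [← Finsupp.range_linearCombination]
    exact LinearMap.mem_range_self A u
  obtain ⟨s, hs⟩ := A'.exists_rightInverse_of_surjective (LinearMap.range_eq_top.2 fun v => by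
    obtain ⟨u, hu⟩ := hr v
    exact ⟨u, Subtype.ext hu⟩)
  have hsA : ∀ v, A (s v) = v := fun v => congrArg Subtype.val (LinearMap.congr_fun hs v)
  refine ⟨⟨B ∘ₗ s, fun v => ?_⟩, fun i => ?_, fun u => ?_⟩
  · rw [LinearMap.comp_apply, ← hnorm, hsA]
    rfl
  -- Equal norms make `B` vanish wherever `A` does, so the choice of the section `s` is immaterial.
  · have hd : B (s ⟨x i, Submodule.subset_span (Set.mem_range_self i)⟩ - Finsupp.single i 1) = 0 := by
      rw [← norm_eq_zero, ← hnorm, map_sub, hsA]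
      simp [hA]
    rw [map_sub, sub_eq_zero] at hd
    refine hd.trans ?_
    simp [hB]
  · rw [← Finsupp.range_linearCombination]
    exact LinearMap.mem_range_self B (s u)

/-- The invariant Gram kernel of each homogeneous part matches, after division by a constant, that
of the tensor power; orthogonality of the images passes to spans. -/
theorem exists_orthogonalSumOfTensorProducts {n N : ℕ} {f : Ball n → Ball N}
    (hf : IsHolomorphic f) (hU : (unitaryToAut n).range ≤ sourceGroup f) :
    ∃ g : Ball n → Ball N, SphericallyEquivalent f g ∧ IsOrthogonalSumOfTensorProducts g := by
  obtain ⟨φ, hf0, h0, -⟩ := hf.exists_normalization 1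
  refine ⟨φ.toFun ∘ f ∘ (1 : Aut n).toFun, sphericallyEquivalent_comp f φ 1, ?_⟩
  have hU' : (unitaryToAut n).range ≤ sourceGroup (φ.toFun ∘ f ∘ (1 : Aut n).toFun) := by
    intro γ hγ
    rw [mem_sourceGroup_comp, one_mul, inv_one, mul_one]
    exact hU hγ
  generalize φ.toFun ∘ f ∘ (1 : Aut n).toFun = g at *
  obtain ⟨S, Q, hS1, hd, hh, hne, ho, hsum⟩ := exists_homogeneous_expansion_of_center hf0 h0
    ((Subgroup.map_le_range _ _).trans hU')
  have hball : ∀ (L : Cn n ≃ₗᵢ[ℂ] Cn n) (z w : Ball n), ∀ m ∈ S,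
      inner ℂ (Q m (L z)) (Q m (L w)) = inner ℂ (Q m z) (Q m w) := by
    intro L z w
    obtain ⟨U, hUL⟩ := exists_unitaryToAut_eq L
    obtain ⟨V, hV⟩ := exists_isometry_of_mem_sourceGroup h0 (hU' ⟨U, rfl⟩) (unitaryToAut_origin U)
    rw [hUL] at hV
    have hexp : ∀ a b : Ball n, inner ℂ (g a : Cn N) (g b)
        = ∑ m ∈ S, inner ℂ (Q m a) (Q m b) := by
      intro a b
      rw [hsum, hsum, sum_inner]
      refine Finset.sum_congr rfl fun m hm => ?_
      rw [inner_sum]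
      exact Finset.sum_eq_single_of_mem m hm fun k hk hkm => ho m hm k hk hkm.symm _ _
    -- Replacing `w` by `l • w` turns invariance of the full kernel into a polynomial identity in
    -- `l`, which separates the degrees.
    have key := eq_zero_of_sum_pow_mul_eq_zero (S := S)
      (a := fun m => inner ℂ (Q m (L z)) (Q m (L w)) - inner ℂ (Q m z) (Q m w)) fun l hl => ?_
    · exact fun m hm => sub_eq_zero.1 (key m hm)
    · have hlw : ‖l • (w : Cn n)‖ < 1 := by
        rw [norm_smul]
        exact mul_lt_one_of_nonneg_of_lt_one_left (norm_nonneg _) hl w.norm_lt.le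
      let w' : Ball n := ⟨l • (w : Cn n), mem_ball_zero_iff.2 hlw⟩
      have h1 : inner ℂ (g ((isometryToAut n L).toFun z) : Cn N) (g ((isometryToAut n L).toFun w'))
          = inner ℂ (g z : Cn N) (g w') := by
        rw [hV, hV, V.inner_map_map]
      rw [hexp, hexp, ← sub_eq_zero, ← Finset.sum_sub_distrib] at h1
      rw [← h1]
      refine Finset.sum_congr rfl fun m hm => ?_
      change _ = inner ℂ (Q m (L z)) (Q m (L (l • (w : Cn n))))
        - inner ℂ (Q m z) (Q m (l • (w : Cn n)))
      rw [map_smul, hh m hm, hh m hm, inner_smul_right, inner_smul_right, mul_sub]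
  have hall : ∀ m ∈ S, ∀ (L : Cn n ≃ₗᵢ[ℂ] Cn n) (z w : Cn n),
      inner ℂ (Q m (L z)) (Q m (L w)) = inner ℂ (Q m z) (Q m w) := by
    intro m hm L z w
    obtain ⟨c, z', hz', rfl⟩ := exists_smul_eq_of_norm_lt_one z
    obtain ⟨d, w', hw', rfl⟩ := exists_smul_eq_of_norm_lt_one w
    rw [map_smul, map_smul, hh m hm, hh m hm, hh m hm, hh m hm, inner_smul_left, inner_smul_right,
      inner_smul_left, inner_smul_right,
      hball L ⟨z', mem_ball_zero_iff.2 hz'⟩ ⟨w', mem_ball_zero_iff.2 hw'⟩ m hm]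
  have key : ∀ m : S, ∃ (c : ℂ) (V : symTensors n m →ₗᵢ[ℂ] Cn N),
      (∀ z, Q m z = c • V (symPow m z)) ∧
      ∀ u, V u ∈ Submodule.span ℂ (Set.range (Q m)) := by
    intro ⟨m, hm⟩
    obtain ⟨C, hC, hQC⟩ := exists_inner_eq_pow (hS1 m hm) (hd m hm) (hh m hm) (hne m hm) (hall m hm)
    have hs : (Real.sqrt C : ℂ) ≠ 0 := by exact_mod_cast (Real.sqrt_pos.2 hC).ne'
    have hss : (Real.sqrt C : ℂ) * Real.sqrt C = C := by
      exact_mod_cast Real.mul_self_sqrt hC.le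
    obtain ⟨V, hV, hVr⟩ := exists_linearIsometry_of_gram (tensorPow (n := n) m)
      (fun z => (Real.sqrt C : ℂ)⁻¹ • Q m z) (fun z w => by
        rw [inner_tensorPow, inner_smul_left, inner_smul_right, hQC, map_inv₀, Complex.conj_ofReal,
          ← hss]
        field_simp)
    refine ⟨Real.sqrt C, V, fun z => ?_, fun u => ?_⟩
    · have : V (symPow m z) = (Real.sqrt C : ℂ)⁻¹ • Q m z := hV z
      calc Q m z = (Real.sqrt C : ℂ) • (Real.sqrt C : ℂ)⁻¹ • Q m z := (smul_inv_smul₀ hs _).symm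
        _ = (Real.sqrt C : ℂ) • V (symPow m z) := congrArg _ this.symm
    · refine Submodule.span_le.2 ?_ (hVr u)
      rintro _ ⟨z, rfl⟩
      exact Submodule.smul_mem _ _ (Submodule.subset_span (Set.mem_range_self z))
  choose c V hV hVr using key
  -- The value `0` outside `S` is a filler that never enters the sum.
  refine ⟨S, fun m => if h : m ∈ S then c ⟨m, h⟩ else 0, V, hS1, ?_, ?_⟩
  · intro m k hmk u v
    have horth : Submodule.span ℂ (Set.range (Q m)) ⟂ Submodule.span ℂ (Set.range (Q k)) := by
      rw [Submodule.isOrtho_span]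
      rintro _ ⟨z, rfl⟩ _ ⟨w, rfl⟩
      exact ho m m.2 k k.2 (fun h => hmk (Subtype.ext h)) z w
    exact Submodule.isOrtho_iff_inner_eq.1 horth _ (hVr m u) _ (hVr k v)
  · intro z
    rw [hsum, ← Finset.sum_coe_sort S (fun m => Q m z)]
    refine Finset.sum_congr rfl fun m _ => ?_
    change _ = (if h : (m : ℕ) ∈ S then c ⟨m, h⟩ else 0) • V m (symPow m z)
    rw [hV, dif_pos m.2]

/-! ### Noncompact source groups -/

/-- If a map that fixes the origin extends continuously to the whole space and all automorphisms in
its source group fix the origin, then the source group is compact. -/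
theorem isCompact_sourceGroup {n N : ℕ} {f : Ball n → Ball N}
    (h0 : f (Ball.origin n) = Ball.origin N) {F : Cn n → Cn N} (hF : Continuous F)
    (hFf : ∀ z : Ball n, (f z : Cn N) = F z)
    (hfix : ∀ γ ∈ sourceGroup f, γ.toFun (Ball.origin n) = Ball.origin n) :
    IsCompact (sourceGroup f : Set (Aut n)) := by
  set K : Set ((Cn n →L[ℂ] Cn n) × (Cn N →L[ℂ] Cn N)) :=
    {p | (∀ z, ‖p.1 z‖ = ‖z‖) ∧ (∀ z, ‖p.2 z‖ = ‖z‖) ∧ ∀ z : Ball n, F (p.1 z) = p.2 (F z)}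
    with hK
  have hclosed : IsClosed K := by
    have e : K = (⋂ z, {p | ‖p.1 z‖ = ‖z‖}) ∩ ((⋂ z, {p | ‖p.2 z‖ = ‖z‖}) ∩
        ⋂ z : Ball n, {p | F (p.1 z) = p.2 (F z)}) := by
      ext p
      simp [hK]
    rw [e]
    refine IsClosed.inter (isClosed_iInter fun z => ?_) (IsClosed.inter
      (isClosed_iInter fun z => ?_) (isClosed_iInter fun z => ?_))
    · exact isClosed_eq (by fun_prop) (by fun_prop)
    · exact isClosed_eq (by fun_prop) (by fun_prop)
    · exact isClosed_eq (by fun_prop) (by fun_prop)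
  have hsub : K ⊆ Metric.closedBall 0 1 := by
    rintro ⟨A, B⟩ ⟨hA, hB, -⟩
    rw [mem_closedBall_zero_iff, Prod.norm_def]
    exact max_le (A.opNorm_le_bound zero_le_one fun z => by rw [hA, one_mul])
      (B.opNorm_le_bound zero_le_one fun z => by rw [hB, one_mul])
  have : ProperSpace ((Cn n →L[ℂ] Cn n) × (Cn N →L[ℂ] Cn N)) := FiniteDimensional.proper ℂ _
  have hcomp : IsCompact K := (isCompact_closedBall _ _).of_isClosed_subset hclosed hsub
  have : CompactSpace K := isCompact_iff_compactSpace.1 hcomp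
  let e : K → Aut n := fun p => isometryToAut n
    (LinearIsometry.toLinearIsometryEquiv ⟨p.1.1.toLinearMap, p.2.1⟩ rfl)
  have he : ∀ (p : K) (z : Ball n), ((e p).toFun z : Cn n) = p.1.1 z := fun _ _ => rfl
  have hcont : Continuous e := by
    -- For the compact-open topology, joint continuity of evaluation suffices.
    refine continuous_induced_rng.2 (ContinuousMap.continuous_of_continuous_uncurry _ ?_)
    refine continuous_induced_rng.2 ?_
    change Continuous fun q : K × Ball n => q.1.1.1 (q.2 : Cn n)
    fun_prop
  have hrange : (sourceGroup f : Set (Aut n)) = Set.range e := by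
    ext γ
    constructor
    · intro hγ
      obtain ⟨L, hL⟩ := exists_isometry_of_mem_sourceGroup h0 hγ (hfix γ hγ)
      obtain ⟨M, rfl⟩ := γ.exists_isometry (hfix γ hγ)
      refine ⟨⟨(M.toContinuousLinearEquiv.toContinuousLinearMap,
        L.toContinuousLinearEquiv.toContinuousLinearMap), M.norm_map, L.norm_map, fun z => ?_⟩, ?_⟩
      · have h1 := hL z
        rw [hFf, hFf] at h1
        exact h1
      · exact Aut.ext fun z => rfl
    · rintro ⟨p, rfl⟩
      let V : Cn N ≃ₗᵢ[ℂ] Cn N :=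
        LinearIsometry.toLinearIsometryEquiv ⟨p.1.2.toLinearMap, p.2.2.1⟩ rfl
      refine mem_sourceGroup.2 ⟨isometryToAut N V, fun z => Subtype.ext ?_⟩
      rw [isometryToAut_apply, hFf, hFf, he, p.2.2.2]
      rfl
  rw [hrange]
  exact isCompact_range hcont

/-! ### Degree bound when the source group moves the origin -/

/-- A polynomial of degree at most `d` that vanishes to order `d` at `τ⁻¹` and takes the value `1` at
`0` is `(1 - τ X) ^ d`; this computes its linear coefficient. -/
theorem coeff_one_of_smul_eq_pow_smul {H : Type*} [NormedAddCommGroup H] [NormedSpace ℂ H]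
    {p : Polynomial ℂ} {d : ℕ} {τ : ℂ} (hτ : τ ≠ 0) (hd : 1 ≤ d) (hp : p.natDegree ≤ d)
    (hp0 : p.eval 0 = 1) {F G : ℂ → H} (hF : Continuous F) (hG : Continuous G)
    (hFG : ∀ l, p.eval l • F l = (1 - l * τ) ^ d • G l) (hne : F τ⁻¹ ≠ 0) :
    p.coeff 1 = -(d * τ) := by
  have hpne : p ≠ 0 := by
    rintro rfl
    simp at hp0
  obtain ⟨q, hq, hqd⟩ := Polynomial.exists_eq_pow_rootMultiplicity_mul_and_not_dvd p hpne τ⁻¹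
  set k := p.rootMultiplicity τ⁻¹
  have hq0 : q.eval τ⁻¹ ≠ 0 := fun h => hqd (Polynomial.dvd_iff_isRoot.2 h)
  -- If the root had multiplicity `k < d`, cancelling `(l - τ⁻¹) ^ k` and letting `l` tend to `τ⁻¹`
  -- would equate a nonzero vector with zero.
  have hkd : d ≤ k := by
    by_contra hlt
    push Not at hlt
    have hev : ∀ l : ℂ, l ≠ τ⁻¹ →
        q.eval l • F l = ((-τ) ^ d * (l - τ⁻¹) ^ (d - k)) • G l := by
      intro l hl
      have h1 := hFG l
      have h2 : 1 - l * τ = -τ * (l - τ⁻¹) := by field_simp; ring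
      have h3 : d = k + (d - k) := by omega
      have h4 : (l - τ⁻¹) ^ d = (l - τ⁻¹) ^ k * (l - τ⁻¹) ^ (d - k) := by
        rw [← pow_add, ← h3]
      rw [hq, h2, mul_pow, h4] at h1
      simp only [Polynomial.eval_mul, Polynomial.eval_pow, Polynomial.eval_sub, Polynomial.eval_X,
        Polynomial.eval_C] at h1
      rw [mul_smul, mul_left_comm, mul_smul] at h1
      exact smul_right_injective H (pow_ne_zero k (sub_ne_zero.2 hl)) h1
    have hl1 : Filter.Tendsto (fun l => q.eval l • F l) (nhdsWithin τ⁻¹ {τ⁻¹}ᶜ)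
        (nhds (q.eval τ⁻¹ • F τ⁻¹)) :=
      ((q.continuous.smul hF).tendsto _).mono_left nhdsWithin_le_nhds
    have hl2 : Filter.Tendsto (fun l => ((-τ) ^ d * (l - τ⁻¹) ^ (d - k)) • G l)
        (nhdsWithin τ⁻¹ {τ⁻¹}ᶜ) (nhds (((-τ) ^ d * (τ⁻¹ - τ⁻¹) ^ (d - k)) • G τ⁻¹)) := by
      have : Continuous fun l => ((-τ) ^ d * (l - τ⁻¹) ^ (d - k)) • G l := by fun_prop
      exact (this.tendsto _).mono_left nhdsWithin_le_nhds
    have h5 := tendsto_nhds_unique_of_eventuallyEq hl1 hl2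
      (eventually_nhdsWithin_of_forall fun l hl => hev l hl)
    rw [sub_self, zero_pow (by omega), mul_zero, zero_smul] at h5
    exact (smul_ne_zero hq0 hne) h5
  have hdvd : (Polynomial.X - Polynomial.C τ⁻¹) ^ d ∣ p :=
    (pow_dvd_pow _ hkd).trans ⟨q, hq⟩
  obtain ⟨r, hr⟩ := hdvd
  have hmonic : ((Polynomial.X - Polynomial.C τ⁻¹) ^ d).Monic :=
    (Polynomial.monic_X_sub_C _).pow d
  have hrne : r ≠ 0 := by
    rintro rfl
    exact hpne (by rw [hr, mul_zero])
  -- The degree bound leaves a constant cofactor, which the value `1` at `0` determines.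
  have hrdeg : r.natDegree = 0 := by
    have h1 := hmonic.natDegree_mul' hrne
    rw [← hr, (Polynomial.monic_X_sub_C τ⁻¹).natDegree_pow, Polynomial.natDegree_X_sub_C] at h1
    omega
  obtain ⟨c, rfl⟩ := Polynomial.natDegree_eq_zero.1 hrdeg
  have h1 : p.coeff 1 = p.derivative.eval 0 := by
    rw [← Polynomial.coeff_zero_eq_eval_zero, Polynomial.coeff_derivative]
    simp
  obtain ⟨e, rfl⟩ : ∃ e, d = e + 1 := ⟨d - 1, by omega⟩
  rw [h1, hr]
  rw [hr] at hp0
  simp only [Polynomial.eval_mul, Polynomial.eval_pow, Polynomial.eval_sub, Polynomial.eval_X,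
    Polynomial.eval_C, zero_sub] at hp0
  simp only [Polynomial.derivative_mul, Polynomial.derivative_C, mul_zero, add_zero,
    Polynomial.derivative_X_sub_C_pow, Polynomial.eval_mul, Polynomial.eval_C,
    Polynomial.eval_pow, Polynomial.eval_sub, Polynomial.eval_X, zero_sub,
    Nat.add_sub_cancel]
  rw [pow_succ] at hp0
  have h2 : (-τ⁻¹) ^ e * c = -τ := by
    have h3 : (-τ⁻¹) * (-τ) = 1 := by field_simp
    calc (-τ⁻¹) ^ e * c = ((-τ⁻¹) ^ e * (-τ⁻¹) * c) * (-τ) := by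
          linear_combination (-(-τ⁻¹) ^ e * c) * h3
      _ = -τ := by rw [hp0, one_mul]
  linear_combination ((e + 1 : ℕ) : ℂ) * h2

/-- A homogeneous expansion of a map whose source group moves the origin has no terms of degree
greater than one. -/
theorem degree_le_one_of_sourceGroup {n N : ℕ} {f : Ball n → Ball N} (hf : IsHolomorphic f)
    (h0 : f (Ball.origin n) = Ball.origin N) {S : Finset ℕ} {Q : ℕ → Cn n → Cn N}
    (hd : ∀ m ∈ S, Differentiable ℂ (Q m))
    (hh : ∀ m ∈ S, ∀ (l : ℂ) (z : Cn n), Q m (l • z) = l ^ m • Q m z)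
    (hne : ∀ m ∈ S, ∃ z, Q m z ≠ 0)
    (ho : ∀ m ∈ S, ∀ k ∈ S, m ≠ k → ∀ z w, inner ℂ (Q m z) (Q k w) = 0)
    (hsum : ∀ z : Ball n, (f z : Cn N) = ∑ m ∈ S, Q m z)
    {γ : Aut n} (hγ : γ ∈ sourceGroup f) (hγ0 : γ.toFun (Ball.origin n) ≠ Ball.origin n) :
    ∀ m ∈ S, m ≤ 1 := by
  classical
  obtain ⟨ψ, hψ⟩ := mem_sourceGroup.1 hγ
  set a : Ball n := γ⁻¹.toFun (Ball.origin n) with ha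
  have hγa : γ.toFun a = Ball.origin n := γ.toFun_inv_toFun _
  have ha0 : (a : Cn n) ≠ 0 := by
    intro h
    have : a = Ball.origin n := Subtype.ext h
    rw [this] at hγa
    exact hγ0 hγa
  set b : Ball N := f a with hb
  obtain ⟨U, hU⟩ := γ.exists_isometry_mul_mobius a hγa
  obtain ⟨V, hV⟩ := ψ.exists_isometry_mul_mobius b (by rw [hb, ← hψ, hγa, h0])
  have hb1 : (1 : ℕ) ∈ S → ∀ w, inner ℂ (b : Cn N) (Q 1 w) = inner ℂ (Q 1 a) (Q 1 w) := by
    intro h1 w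
    rw [hb, hsum, sum_inner]
    exact Finset.sum_eq_single_of_mem 1 h1 fun k hk hk1 => ho k hk 1 h1 hk1 _ _
  by_contra! hcon
  obtain ⟨m₀, hm₀, hm₀1⟩ := hcon
  set d := S.max' ⟨m₀, hm₀⟩ with hddef
  have hdS : d ∈ S := S.max'_mem _
  have hSd : ∀ m ∈ S, m ≤ d := fun m hm => S.le_max' m hm
  have hd2 : 2 ≤ d := (Nat.succ_le_of_lt hm₀1).trans (hSd _ hm₀)
  set s := defect (a : Cn n) with hs
  have hs0 : (s : ℂ) ≠ 0 := by exact_mod_cast (defect_pos a.norm_lt).ne'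
  have hs1 := one_add_defect_ne_zero (a : Cn n)
  have hρ : inner ℂ (a : Cn n) (a : Cn n) = (1 - s) * (1 + s : ℂ) := by
    rw [inner_self_eq_norm_sq_to_K]
    have : ((‖(a : Cn n)‖ ^ 2 : ℝ) : ℂ) = ((1 - s ^ 2 : ℝ) : ℂ) := by
      rw [hs, defect_sq a.norm_lt, sub_sub_cancel]
    push_cast at this
    refine this.trans ?_
    ring
  have hρ0 : inner ℂ (a : Cn n) (a : Cn n) ≠ 0 := fun h => ha0 (inner_self_eq_zero.1 h)
  set q₁ : Cn n → Cn N := fun w => if 1 ∈ S then Q 1 w else 0 with hq₁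
  -- the linear part is determined in all directions that are not exceptional
  have hlin : ∀ w : Cn n, inner ℂ (a : Cn n) w ≠ 0 →
      Q d (U (mobiusNum a ((inner ℂ (a : Cn n) w)⁻¹ • w))) ≠ 0 →
      inner ℂ (b : Cn N) (q₁ w) = d * inner ℂ (a : Cn n) w := by
    intro w hτ hdir
    set τ := inner ℂ (a : Cn n) w with hτdef
    set p : Polynomial ℂ := 1 - ∑ m ∈ S, Polynomial.monomial m (inner ℂ (b : Cn N) (Q m w)) with hp
    have hpeval : ∀ l, p.eval l = 1 - inner ℂ (b : Cn N) (∑ m ∈ S, Q m (l • w)) := by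
      intro l
      rw [hp, Polynomial.eval_sub, Polynomial.eval_one, Polynomial.eval_finsetSum, inner_sum]
      congr 1
      refine Finset.sum_congr rfl fun m hm => ?_
      rw [Polynomial.eval_monomial, hh m hm, inner_smul_right, mul_comm]
    have hQ0 : ∑ m ∈ S, Q m 0 = 0 := by
      have := hsum (Ball.origin n)
      rw [h0] at this
      exact this.symm
    have hpdeg : p.natDegree ≤ d := by
      rw [hp]
      refine (Polynomial.natDegree_sub_le _ _).trans (max_le (by simp) ?_)
      exact Polynomial.natDegree_sum_le_of_forall_le S _ fun m hm =>
        (Polynomial.natDegree_monomial_le _).trans (hSd m hm)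
    have hfd : Differentiable ℂ fun l : ℂ => ∑ m ∈ S, Q m (l • w) :=
      Differentiable.fun_sum fun m hm => (hd m hm).comp (by fun_prop)
    have hNd : Differentiable ℂ fun l : ℂ => U (mobiusNum (a : Cn n) (l • w)) :=
      U.toContinuousLinearEquiv.differentiable.comp
        ((differentiable_mobiusNum (a : Cn n)).comp (by fun_prop))
    -- `F` is `f ∘ γ` on the line after multiplication by `(1 - l τ) ^ d`, and `G` is `ψ ∘ f` after
    -- multiplication by `p`.
    set F : ℂ → Cn N := fun l => ∑ m ∈ S, (1 - l * τ) ^ (d - m) •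
      Q m (U (mobiusNum (a : Cn n) (l • w))) with hF
    set G : ℂ → Cn N := fun l => V (mobiusNum (b : Cn N) (∑ m ∈ S, Q m (l • w))) with hG
    have hFd : Differentiable ℂ F := Differentiable.fun_sum fun m hm => by
      have := (hd m hm).comp hNd
      exact Differentiable.fun_smul (by fun_prop) this
    have hGd : Differentiable ℂ G :=
      V.toContinuousLinearEquiv.differentiable.comp
        ((differentiable_mobiusNum (b : Cn N)).comp hfd)
    have hloc : ∀ l : ℂ, ‖l • w‖ < 1 → p.eval l • F l = (1 - l * τ) ^ d • G l := by
      intro l hl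
      let z : Ball n := ⟨l • w, mem_ball_zero_iff.2 hl⟩
      have hℓ : 1 - l * τ ≠ 0 := by
        have := one_sub_inner_ne_zero a.norm_lt hl
        rwa [inner_smul_right] at this
      have hD : p.eval l ≠ 0 := by
        rw [hpeval, ← hsum z]
        exact one_sub_inner_ne_zero b.norm_lt (f z).norm_lt
      have h1 : (f (γ.toFun z) : Cn N)
          = ∑ m ∈ S, ((1 - l * τ)⁻¹) ^ m • Q m (U (mobiusNum (a : Cn n) (l • w))) := by
        rw [hsum]
        refine Finset.sum_congr rfl fun m hm => ?_
        rw [← hh m hm, ← map_smul, hU]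
        change Q m (U (mobiusFun (a : Cn n) (l • w))) = _
        rw [mobiusFun, inner_smul_right]
      have h2 : (f (γ.toFun z) : Cn N) = (p.eval l)⁻¹ • G l := by
        rw [hψ, hV]
        change V (mobiusFun (b : Cn N) (f z)) = _
        rw [mobiusFun, map_smul, hpeval, hsum z]
      rw [h2] at h1
      have h3 : F l = (1 - l * τ) ^ d • ∑ m ∈ S, ((1 - l * τ)⁻¹) ^ m •
          Q m (U (mobiusNum (a : Cn n) (l • w))) := by
        rw [hF, Finset.smul_sum]
        refine Finset.sum_congr rfl fun m hm => ?_
        rw [smul_smul]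
        congr 1
        rw [inv_pow, pow_sub₀ _ hℓ (hSd m hm)]
      rw [h3, ← h1, smul_comm, smul_inv_smul₀ hD]
    -- Both sides are entire in `l`; the extension is needed because `τ⁻¹ • w` lies outside the
    -- ball.
    have hglob : ∀ l : ℂ, p.eval l • F l = (1 - l * τ) ^ d • G l := by
      have hL : Differentiable ℂ fun l => p.eval l • F l :=
        Differentiable.fun_smul p.differentiable hFd
      have hR : Differentiable ℂ fun l => (1 - l * τ) ^ d • G l :=
        Differentiable.fun_smul (by fun_prop) hGd
      refine congrFun (AnalyticOnNhd.eq_of_eventuallyEq (𝕜 := ℂ) (z₀ := 0)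
        (hL.differentiableOn.analyticOnNhd isOpen_univ)
        (hR.differentiableOn.analyticOnNhd isOpen_univ) ?_)
      have hc : Continuous fun l : ℂ => ‖l • w‖ := by fun_prop
      filter_upwards [hc.tendsto 0 |>.eventually_lt_const (by simp : ‖(0 : ℂ) • w‖ < 1)] with l hl
      exact hloc l hl
    have hFne : F τ⁻¹ ≠ 0 := by
      have : F τ⁻¹ = Q d (U (mobiusNum (a : Cn n) (τ⁻¹ • w))) := by
        simp only [hF]
        rw [inv_mul_cancel₀ hτ, sub_self, Finset.sum_eq_single_of_mem d hdS]
        · rw [Nat.sub_self, pow_zero, one_smul]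
        · intro m hm hmd
          have := hSd m hm
          rw [zero_pow (by omega), zero_smul]
      rw [this]
      exact hdir
    have hcoeff := coeff_one_of_smul_eq_pow_smul hτ (by omega) hpdeg
      (by rw [hpeval, zero_smul, hQ0, inner_zero_right, sub_zero]) hFd.continuous hGd.continuous
      hglob hFne
    have hc1 : p.coeff 1 = - inner ℂ (b : Cn N) (q₁ w) := by
      rw [hp, Polynomial.coeff_sub, Polynomial.coeff_one, if_neg (by norm_num), zero_sub,
        Polynomial.finsetSum_coeff]
      congr 1
      simp only [Polynomial.coeff_monomial, Finset.sum_ite_eq', hq₁]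
      split_ifs
      · rfl
      · rw [inner_zero_right]
    rw [hc1] at hcoeff
    exact neg_injective hcoeff
  -- a direction orthogonal to `a` that is not exceptional
  obtain ⟨q, hq, t₀, ht₀⟩ : ∃ q : Cn n, inner ℂ (a : Cn n) q = 0 ∧
      ∃ t : ℂ, Q d (U ((s : ℂ) • (a : Cn n) + t • q)) ≠ 0 := by
    obtain ⟨z, hz⟩ := hne d hdS
    set y := U.symm z
    set c := inner ℂ (a : Cn n) y / inner ℂ (a : Cn n) (a : Cn n) with hc
    refine ⟨y - c • (a : Cn n), ?_, ?_⟩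
    · rw [inner_sub_right, inner_smul_right, hc, div_mul_cancel₀ _ hρ0, sub_self]
    -- The given nonvanishing point may have no component along `a`; a small shift provides one, and
    -- homogeneity rescales it to `s`.
    · have hk : Continuous fun x : ℂ => Q d (U (x • (a : Cn n) + (y - c • (a : Cn n)))) :=
        (hd d hdS).continuous.comp (U.continuous.comp (by fun_prop))
      have hkc : Q d (U (c • (a : Cn n) + (y - c • (a : Cn n)))) ≠ 0 := by
        rw [add_sub_cancel, U.apply_symm_apply]
        exact hz
      obtain ⟨x, hx, hx0⟩ : ∃ x : ℂ, Q d (U (x • (a : Cn n) + (y - c • (a : Cn n)))) ≠ 0 ∧ x ≠ 0 := by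
        have h1 : ∀ᶠ x in nhdsWithin c {c}ᶜ,
            Q d (U (x • (a : Cn n) + (y - c • (a : Cn n)))) ≠ 0 :=
          nhdsWithin_le_nhds (hk.continuousAt.eventually_ne hkc)
        have h2 : ∀ᶠ x in nhdsWithin c {c}ᶜ, x ≠ 0 := by
          rcases eq_or_ne c 0 with h | h
          · rw [h]; exact self_mem_nhdsWithin
          · exact nhdsWithin_le_nhds (isOpen_ne.mem_nhds h)
        exact (h1.and h2).exists
      refine ⟨s / x, fun h => hx ?_⟩
      have h1 : (s : ℂ) • (a : Cn n) + ((s : ℂ) / x) • (y - c • (a : Cn n))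
          = ((s : ℂ) / x) • (x • (a : Cn n) + (y - c • (a : Cn n))) := by
        rw [smul_add _ (x • (a : Cn n)), smul_smul, div_mul_cancel₀ _ hx0]
      rw [h1, map_smul, hh d hdS] at h
      exact (smul_eq_zero.1 h).resolve_left (pow_ne_zero _ (div_ne_zero hs0 hx0))
  have hmain : inner ℂ (b : Cn N) (q₁ a) = d * inner ℂ (a : Cn n) (a : Cn n) := by
    have hhd : Differentiable ℂ fun t : ℂ => Q d (U ((s : ℂ) • (a : Cn n) + t • q)) :=
      (hd d hdS).comp (U.toContinuousLinearEquiv.differentiable.comp (by fun_prop))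
    have hhan : AnalyticOnNhd ℂ (fun t : ℂ => Q d (U ((s : ℂ) • (a : Cn n) + t • q))) Set.univ :=
      hhd.differentiableOn.analyticOnNhd isOpen_univ
    -- The value `w = a` itself may be exceptional, but by analyticity `a + t q` is not for small `t
    -- ≠ 0`, so the identity at `a` is a limit.
    have hev : ∀ᶠ t in nhdsWithin (0 : ℂ) {0}ᶜ, Q d (U ((s : ℂ) • (a : Cn n) + t • q)) ≠ 0 := by
      refine (hhan 0 trivial).eventually_eq_zero_or_eventually_ne_zero.resolve_left fun h => ht₀ ?_
      exact hhan.eqOn_zero_of_preconnected_of_eventuallyEq_zero isPreconnected_univ trivial h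
        (Set.mem_univ t₀)
    have hq₁c : Continuous q₁ := by
      simp only [hq₁]
      split_ifs with h1
      · exact (hd 1 h1).continuous
      · exact continuous_const
    have hlim : Filter.Tendsto (fun t : ℂ => inner ℂ (b : Cn N) (q₁ ((a : Cn n) + t • q)))
        (nhdsWithin 0 {0}ᶜ) (nhds (inner ℂ (b : Cn N) (q₁ a))) := by
      have hc : Continuous fun t : ℂ => inner ℂ (b : Cn N) (q₁ ((a : Cn n) + t • q)) := by fun_prop
      have := hc.tendsto 0
      rw [zero_smul, add_zero] at this
      exact this.mono_left nhdsWithin_le_nhds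
    refine tendsto_nhds_unique_of_eventuallyEq hlim tendsto_const_nhds ?_
    filter_upwards [hev] with t ht
    have hτ : inner ℂ (a : Cn n) ((a : Cn n) + t • q) = inner ℂ (a : Cn n) (a : Cn n) := by
      rw [inner_add_right, inner_smul_right, hq, mul_zero, add_zero]
    -- This is where the test vectors `s a + t q` come from: up to a nonzero scalar they are the
    -- Möbius numerators at `(a + t q) / ⟨a, a⟩`.
    have hN : mobiusNum (a : Cn n) ((inner ℂ (a : Cn n) (a : Cn n))⁻¹ • ((a : Cn n) + t • q))
        = (-(s / inner ℂ (a : Cn n) (a : Cn n))) • ((s : ℂ) • (a : Cn n) + t • q) := by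
      rw [mobiusNum, inner_smul_right, hτ, inv_mul_cancel₀ hρ0, smul_smul, ← hs, smul_add, smul_add,
        ← sub_sub, ← sub_smul, sub_eq_add_neg, ← neg_smul, smul_smul _ (s : ℂ)]
      congr 2
      rw [hρ] at hρ0 ⊢
      have h1 : (1 - s : ℂ) ≠ 0 := left_ne_zero_of_mul hρ0
      have h2 : (1 + s : ℂ) ≠ 0 := hs1
      change 1 - 1 / (1 + (s : ℂ)) - _ = _
      field_simp
      ring
    have := hlin ((a : Cn n) + t • q) (by rwa [hτ]) (by
      rw [hτ, hN, map_smul, hh d hdS]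
      exact smul_ne_zero (pow_ne_zero _ (neg_ne_zero.2 (div_ne_zero hs0 hρ0))) ht)
    rwa [hτ] at this
  have hdρ : (d : ℂ) * inner ℂ (a : Cn n) (a : Cn n) ≠ 0 :=
    mul_ne_zero (Nat.cast_ne_zero.2 (by omega)) hρ0
  have h1S : 1 ∈ S := by
    by_contra h
    simp only [hq₁, if_neg h, inner_zero_right] at hmain
    exact hdρ hmain.symm
  simp only [hq₁, if_pos h1S] at hmain
  -- `Q 1 a` is an orthogonal component of `b = f a`, so Cauchy–Schwarz and the Schwarz lemma bound
  -- it by `‖a‖`.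
  have hQb : ‖Q 1 (a : Cn n)‖ ≤ ‖(a : Cn n)‖ := by
    have h1 : ‖Q 1 (a : Cn n)‖ * ‖Q 1 (a : Cn n)‖ ≤ ‖(b : Cn N)‖ * ‖Q 1 (a : Cn n)‖ := by
      have h2 := norm_inner_le_norm (𝕜 := ℂ) (b : Cn N) (Q 1 a)
      rw [hb1 h1S, inner_self_eq_norm_sq_to_K] at h2
      simpa [sq] using h2
    have h3 : ‖(b : Cn N)‖ ≤ ‖(a : Cn n)‖ := norm_le_of_isHolomorphic hf h0 a
    rcases eq_or_ne (Q 1 (a : Cn n)) 0 with h | h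
    · rw [h, norm_zero]; exact norm_nonneg _
    · exact (le_of_mul_le_mul_right h1 (norm_pos_iff.2 h)).trans h3
  rw [hb1 h1S, inner_self_eq_norm_sq_to_K, inner_self_eq_norm_sq_to_K] at hmain
  have hreal : ‖Q 1 (a : Cn n)‖ ^ 2 = d * ‖(a : Cn n)‖ ^ 2 := by
    refine Complex.ofReal_injective ?_
    push_cast
    exact hmain
  have hapos : 0 < ‖(a : Cn n)‖ := norm_pos_iff.2 ha0
  have hd2' : (2 : ℝ) ≤ d := by exact_mod_cast hd2
  nlinarith [pow_le_pow_left₀ (norm_nonneg _) hQb 2, pow_pos hapos 2]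

/-- Differentiate `Q (t z) = t Q z` at `t = 0`. -/
theorem eq_fderiv_of_homogeneous {E H : Type*} [NormedAddCommGroup E] [NormedSpace ℂ E]
    [NormedAddCommGroup H] [NormedSpace ℂ H] {Q : E → H} (hd : Differentiable ℂ Q)
    (hh : ∀ (l : ℂ) (z : E), Q (l • z) = l • Q z) (z : E) : Q z = fderiv ℂ Q 0 z := by
  have h1 : HasFDerivAt Q (fderiv ℂ Q 0) ((0 : ℂ) • z) := by
    rw [zero_smul]
    exact (hd 0).hasFDerivAt
  have h2 : HasDerivAt (fun t : ℂ => t • z) z 0 := by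
    simpa using (hasDerivAt_id (0 : ℂ)).smul_const z
  have h3 : HasDerivAt (fun t : ℂ => Q (t • z)) (fderiv ℂ Q 0 z) 0 := h1.comp_hasDerivAt (0 : ℂ) h2
  have h4 : HasDerivAt (fun t : ℂ => t • Q z) (Q z) 0 := by
    simpa using (hasDerivAt_id (0 : ℂ)).smul_const (Q z)
  simp only [hh] at h3
  exact h4.unique h3

/-- The composition of a linear map with a Möbius involution is linear fractional. -/
theorem isLinearFractional_mobius_comp {n N : ℕ} {f g : Ball n → Ball N} (b : Ball N)
    (hfg : ∀ z, f z = (mobius b).toFun (g z)) (A : Cn n →ₗ[ℂ] Cn N)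
    (hA : ∀ z : Ball n, (g z : Cn N) = A z) : IsLinearFractional f := by
  let ℓ : Cn n →ₗ[ℂ] ℂ := (innerSL ℂ (b : Cn N)).toLinearMap ∘ₗ A
  have hℓ : ∀ z, ℓ z = inner ℂ (b : Cn N) (A z) := fun _ => rfl
  refine ⟨-((1 + (defect (b : Cn N) : ℂ))⁻¹ • ℓ.smulRight (b : Cn N)) - (defect (b : Cn N) : ℂ) • A,
    b, -ℓ, 1, fun z => ⟨?_, ?_⟩⟩
  · rw [LinearMap.neg_apply, hℓ, ← hA, neg_add_eq_sub]
    exact one_sub_inner_ne_zero b.norm_lt (g z).norm_lt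
  · rw [hfg, mobius_apply, mobiusFun, mobiusNum, hA, LinearMap.neg_apply, hℓ, neg_add_eq_sub]
    congr 1
    simp only [LinearMap.sub_apply, LinearMap.neg_apply, LinearMap.smul_apply,
      LinearMap.smulRight_apply, hℓ, smul_smul, sub_smul, one_smul, div_eq_inv_mul]
    abel

/-- Noncompactness supplies an element moving the origin, leaving only degree one in the normalised
map; its normalising Möbius map is an involution, so it also recovers `f`. -/
theorem isLinearFractional_of_noncompact {n N : ℕ} {f : Ball n → Ball N} (hf : IsHolomorphic f)
    (hc : (Subgroup.center (Matrix.unitaryGroup (Fin n) ℂ)).map (unitaryToAut n) ≤ sourceGroup f)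
    (hnc : ¬ IsCompact (sourceGroup f : Set (Aut n))) : IsLinearFractional f := by
  obtain ⟨φ, hf0, h0, b, rfl⟩ := hf.exists_normalization 1
  have hΓ : sourceGroup ((mobius b).toFun ∘ f ∘ (1 : Aut n).toFun) = sourceGroup f := by
    ext γ
    rw [mem_sourceGroup_comp, one_mul, inv_one, mul_one]
  have hfg : ∀ z, f z = (mobius b).toFun (((mobius b).toFun ∘ f ∘ (1 : Aut n).toFun) z) :=
    fun z => (mobius_mobius b (f z)).symm
  generalize (mobius b).toFun ∘ f ∘ (1 : Aut n).toFun = g at *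
  rw [← hΓ] at hc hnc
  obtain ⟨S, Q, hS1, hd, hh, hne, ho, hsum⟩ := exists_homogeneous_expansion_of_center hf0 h0 hc
  obtain ⟨γ, hγ, hγ0⟩ : ∃ γ ∈ sourceGroup g, γ.toFun (Ball.origin n) ≠ Ball.origin n := by
    by_contra! h
    exact hnc (isCompact_sourceGroup h0 (F := fun z => ∑ m ∈ S, Q m z)
      (continuous_finsetSum _ fun m hm => (hd m hm).continuous) hsum h)
  have hle := degree_le_one_of_sourceGroup hf0 h0 hd hh hne ho hsum hγ hγ0
  have hS : S ⊆ {1} := fun m hm =>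
    Finset.mem_singleton.2 (le_antisymm (hle m hm) (hS1 m hm))
  -- An empty index set means that the normalised map is zero.
  rcases Finset.subset_singleton_iff.1 hS with rfl | rfl
  · exact isLinearFractional_mobius_comp b hfg 0 fun z => by simpa using hsum z
  · refine isLinearFractional_mobius_comp b hfg (fderiv ℂ (Q 1) 0).toLinearMap fun z => ?_
    have h1 := Finset.mem_singleton_self 1
    rw [hsum, Finset.sum_singleton]
    exact eq_fderiv_of_homogeneous (hd 1 h1)
      (fun l z => by rw [hh 1 h1, pow_one]) z

end

end BallMap

theorem corollary1p2 {n N : ℕ} (f : BallMap.Ball n → BallMap.Ball N)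
    (hf : BallMap.IsHolomorphic f) (hproper : IsProperMap f) :
    ((∃ β : BallMap.Aut n,
        ((BallMap.diagonalTorus n).map (BallMap.unitaryToAut n)).map (MulAut.conj β).toMonoidHom
          ≤ BallMap.sourceGroup f) →
      ∃ g : BallMap.Ball n → BallMap.Ball N,
        BallMap.SphericallyEquivalent f g ∧ BallMap.IsMonomialMap g) ∧
    ((BallMap.unitaryToAut n).range ≤ BallMap.sourceGroup f →
      ∃ g : BallMap.Ball n → BallMap.Ball N,
        BallMap.SphericallyEquivalent f g ∧ BallMap.IsOrthogonalSumOfTensorProducts g) ∧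
    ((Subgroup.center (Matrix.unitaryGroup (Fin n) ℂ)).map (BallMap.unitaryToAut n)
          ≤ BallMap.sourceGroup f →
      ¬ IsCompact (BallMap.sourceGroup f : Set (BallMap.Aut n)) →
      BallMap.IsLinearFractional f) := by
  exact ⟨fun ⟨β, hβ⟩ => BallMap.exists_monomialMap hf β hβ,
    BallMap.exists_orthogonalSumOfTensorProducts hf,
    BallMap.isLinearFractional_of_noncompact hf⟩
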